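/- Setting. Let $\Delta$ be a finite fan in $N_{\mathbb R}=\mathbb R^n$, $N=\mathbb Z^n$, that contains the cone generated by the standard basis and all of whose maximal cones are generated by $\mathbb Z$-bases of $N$; write $\tau\le\sigma$ if $\tau$ is a face of $\sigma$. Let $M=\mathrm{Hom}(N,\mathbb Z)\cong\mathbb Z^n$, let $\breve M$ be the free group on $n$ letters and $\pi:\breve M\to M$ its abelianization. A soft noncommutative toric scheme on $\Delta$ is a family of finitely generated submonoids $\breve M_\sigma\subset\breve M$ with $\pi(\breve M_\sigma)=\sigma^\vee\cap M$, with $m^{-1}\in\breve M_\sigma$ whenever $m\in\breve M_\sigma$ and $-\pi(m)\in\sigma^\vee$, with $\breve M_\sigma\subset\breve M_\tau$ for $\tau\le\sigma$, free on $n$ letters for $\sigma$ maximal, and equal to $\breve M$ for $\sigma=0$. A soft noncommutative scheme $\breve Y$ is a closed subscheme of it: two-sided ideals $I_\sigma\subset\mathbb C\langle\breve M_\sigma\rangle$ such that $I_\tau$ is generated by the image of $I_\sigma$ for $\tau\le\sigma$. Its structure sheaf $\mathcal O_{\breve Y}$ is the inverse system of $\mathbb C$-algebras $R_\sigma=\mathbb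 C\langle\breve M_\sigma\rangle/I_\sigma$ with the induced maps $R_\sigma\to R_\tau$, $\tau\le\sigma$. Morphisms. Let $X$ be a scheme over $\mathbb C$ and $\mathcal E$ a locally free $\mathcal O_X$-module of rank $r$. For a $\mathbb C$-algebra $A$, a homomorphism $\mathcal O_{\breve Y}\to A$ is a family of $\mathbb C$-linear multiplicative maps $f_\sigma:R_\sigma\to A$ (not necessarily unital) such that, with $e_\sigma=f_\sigma(1)$: for $\tau<\sigma$, $e_\tau e_\sigma=e_\sigma e_\tau=e_\tau$, and for all $a\in R_\sigma$ one has $e_\tau f_\sigma(a)=f_\sigma(a)e_\tau=f_\tau(a|_\tau)$; moreover $e_\sigma e_{\sigma'}=e_{\sigma\cap\sigma'}$ for all $\sigma,\sigma'$, and there are pairwise orthogonal idempotents $r_\sigma\in A$ with $e_\sigma=\sum_{\tau\le\sigma}r_\tau$ and $\sum_{\sigma\in\Delta}r_\sigma=1$. A morphism $\varphi$ from the Azumaya scheme $X^{Az}=(X,\mathcal{E}nd_{\mathcal O_X}(\mathcal E),\mathcal E)$ to $\breve Y$ is a global section of the sheaf on $X$ associated to the presheaf $U\mapsto\{\text{homomorphisms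 }\mathcal O_{\breve Y}\to\mathrm{End}_{\mathcal O_U}(\mathcal E|_U)\}$. The local idempotents $e_\sigma$ and actions $f_\sigma$ of $\varphi$ glue to global ones on $\mathcal E$. Modules and the stack. For a $\mathbb C$-scheme $S$, an $\mathcal O_{S\times\breve Y}$-module $\mathcal F$ is an inverse system of $\mathcal O_S$-modules $\mathcal F_\sigma$, each with a left action of the $\mathbb C$-algebra $R_\sigma$ by $\mathcal O_S$-linear endomorphisms (compatible with the scalars $\mathbb C$), whose transition maps $\mathcal F_\sigma\to\mathcal F_\tau$, $\tau\le\sigma$, are $\mathcal O_S$-linear and linear over $R_\sigma\to R_\tau$. Its direct image to $S$ is $pr_{S,*}\mathcal F=\varprojlim_\sigma\mathcal F_\sigma$, and it is pulled back along $T\to S$ componentwise. Call $\mathcal F$ a flat family over $S$ of $0$-dimensional $\mathcal O_{\breve Y}$-modules of complex dimension $r$ if, after every base change $T\to S$ of $\mathbb C$-schemes, all components are locally free of finite rank over $\mathcal O_T$ and the direct image to $T$ is locally free of rank $r$. Let $\mathfrak M^{0;r}(\breve Y)$ be the category fibered in groupoids over $\mathbb C$-schemes whose fiber over $S$ is the groupoid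 of such families and isomorphisms, with the pullbacks above. Statement. Let $\varphi:X^{Az}\to\breve Y$ be a morphism as above. Then there is a flat family $\widetilde{\mathcal E}$ over $X$ of $0$-dimensional $\mathcal O_{\breve Y}$-modules of complex dimension $r$ which is the graph of $\varphi$, that is, $\widetilde{\mathcal E}_\sigma=e_\sigma\mathcal E$ with $R_\sigma$ acting through $f_\sigma$ and with transition maps $e_\tau:e_\sigma\mathcal E\to e_\tau\mathcal E$; one has $pr_{X,*}\widetilde{\mathcal E}\cong\mathcal E$; and there is a morphism $\Phi:X\to\mathfrak M^{0;r}(\breve Y)$ of categories fibered in groupoids over $\mathbb C$-schemes which classifies $\widetilde{\mathcal E}$, that is, $\Phi(\mathrm{id}_X)\cong\widetilde{\mathcal E}$ over $\mathrm{id}_X$. Any other morphism that classifies $\widetilde{\mathcal E}$ is isomorphic to $\Phi$. -/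

import Mathlib

open CategoryTheory Opposite

namespace SoftNC

/-! ### Fans -/

/-- A finite fan in the lattice `ℤⁿ`: a finite set of rational strongly convex polyhedral cones in
`ℝⁿ`, closed under passing to faces, any two of which meet in a common face. -/
structure Fan (n : ℕ) where
  cones : Set (PointedCone ℝ (Fin n → ℝ))
  finite : cones.Finite
  rational : ∀ σ ∈ cones, ∃ s : Finset (Fin n → ℤ),
    σ = PointedCone.hull ℝ ((fun (v : Fin n → ℤ) (i : Fin n) => (v i : ℝ)) '' (s : Set (Fin n → ℤ)))
  stronglyConvex : ∀ σ ∈ cones, ∀ x ∈ σ, -x ∈ σ → x = 0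
  face_mem : ∀ σ ∈ cones, ∀ τ : PointedCone ℝ (Fin n → ℝ), τ.IsFaceOf σ → τ ∈ cones
  inter_isFaceOf : ∀ σ ∈ cones, ∀ σ' ∈ cones, (σ ⊓ σ').IsFaceOf σ ∧ (σ ⊓ σ').IsFaceOf σ'

variable {n : ℕ}

/-- The index set of cones of a fan. It is ordered by inclusion; for two cones of a fan, `τ ≤ σ`
holds if and only if `τ` is a face of `σ`. -/
abbrev Fan.Cone (Δ : Fan n) : Type := {σ : PointedCone ℝ (Fin n → ℝ) // σ ∈ Δ.cones}

instance (Δ : Fan n) : Finite Δ.Cone := Δ.finite.to_subtype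

/-- The meet of two cones of a fan is their intersection. -/
instance (Δ : Fan n) : SemilatticeInf Δ.Cone :=
  Subtype.semilatticeInf fun _ _ hσ hσ' => Δ.face_mem _ hσ _ (Δ.inter_isFaceOf _ hσ _ hσ').1

theorem Fan.Cone.le_iff_isFaceOf (Δ : Fan n) (τ σ : Δ.Cone) :
    τ ≤ σ ↔ τ.1.IsFaceOf σ.1 := by
  refine ⟨fun h => ?_, fun h => h.le⟩
  have h1 : τ.1 ⊓ σ.1 = τ.1 := inf_eq_left.2 h
  have h2 := (Δ.inter_isFaceOf _ τ.2 _ σ.2).2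
  rwa [h1] at h2

/-- The standing assumption on the fan: the cone generated by the standard basis is in the fan, and
every maximal cone is `n`-dimensional, simplicial and of index one, that is, generated by a basis of
the lattice. -/
structure Fan.IsSmoothWithReferenceCone (Δ : Fan n) : Prop where
  reference_mem : PointedCone.hull ℝ (Set.range fun i : Fin n => (Pi.single i 1 : Fin n → ℝ))
    ∈ Δ.cones
  maximal : ∀ σ : Δ.Cone, IsMax σ → ∃ b : Module.Basis (Fin n) ℤ (Fin n → ℤ),
    σ.1 = PointedCone.hull ℝ (Set.range fun (j : Fin n) (i : Fin n) => (b j i : ℝ))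

/-! ### Soft noncommutative toric schemes -/

/-- The monoid `M_σ = σ^∨ ∩ M`, written multiplicatively, where the dual lattice `M` is identified
with `ℤⁿ` by the dual basis. -/
def dualMonoid (σ : PointedCone ℝ (Fin n → ℝ)) : Submonoid (Multiplicative (Fin n → ℤ)) where
  carrier := {u | ∀ v ∈ σ, 0 ≤ ∑ i, ((Multiplicative.toAdd u i : ℤ) : ℝ) * v i}
  one_mem' := by
    intro v _
    simp
  mul_mem' := by
    intro a b ha hb v hv
    have := add_nonneg (ha v hv) (hb v hv)
    simpa [add_mul, Finset.sum_add_distrib] using this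

/-- The commutatization `π` from the edge-path monoid of `M` (with its standard generators and their
inverses), which is the free group on `n` letters, onto `M = ℤⁿ`. -/
def commutatization (n : ℕ) : FreeGroup (Fin n) →* Multiplicative (Fin n → ℤ) :=
  FreeGroup.lift fun i => Multiplicative.ofAdd (Pi.single i 1)

/-- A submonoid of the edge-path monoid is admissible to the cone `σ`. -/
structure IsAdmissible (σ : PointedCone ℝ (Fin n → ℝ)) (S : Submonoid (FreeGroup (Fin n))) :
    Prop where
  fg : S.FG
  map_eq : S.map (commutatization n) = dualMonoid σ
  inv_mem : ∀ m ∈ S, (commutatization n m)⁻¹ ∈ dualMonoid σ → m⁻¹ ∈ S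

/-- A soft noncommutative toric scheme with smooth fundamental charts associated to a fan: an inverse
system of admissible submonoids, free on `n` letters on maximal cones and equal to the whole
edge-path monoid on the zero cone. -/
structure SoftToricScheme (Δ : Fan n) where
  monoid : Δ.Cone → Submonoid (FreeGroup (Fin n))
  anti : ∀ τ σ : Δ.Cone, τ ≤ σ → monoid σ ≤ monoid τ
  admissible : ∀ σ : Δ.Cone, IsAdmissible σ.1 (monoid σ)
  free : ∀ σ : Δ.Cone, IsMax σ → Nonempty (monoid σ ≃* FreeMonoid (Fin n))
  zero : ∀ σ : Δ.Cone, σ.1 = ⊥ → monoid σ = ⊤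

namespace SoftToricScheme

variable {Δ : Fan n} (Y : SoftToricScheme Δ)

/-- The function ring `ℂ⟨M_σ⟩` of the chart of `σ`. -/
abbrev ring (σ : Δ.Cone) : Type := MonoidAlgebra ℂ (Y.monoid σ)

/-- The inclusion of the function rings of charts for `τ ≤ σ`. -/
noncomputable def incl {τ σ : Δ.Cone} (h : τ ≤ σ) : Y.ring σ →ₐ[ℂ] Y.ring τ :=
  MonoidAlgebra.mapDomainAlgHom ℂ ℂ (Submonoid.inclusion (Y.anti τ σ h))

theorem incl_refl (σ : Δ.Cone) (x : Y.ring σ) : Y.incl (le_refl σ) x = x := by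
  have : Y.incl (le_refl σ) = AlgHom.id ℂ (Y.ring σ) := by
    ext m
    simp [incl]
    rfl
  rw [this]; rfl

theorem incl_incl {ρ τ σ : Δ.Cone} (h : ρ ≤ τ) (h' : τ ≤ σ) (x : Y.ring σ) :
    Y.incl h (Y.incl h' x) = Y.incl (h.trans h') x := by
  have : (Y.incl h).comp (Y.incl h') = Y.incl (h.trans h') := by
    ext m
    simp [incl]
    rfl
  rw [← this]; rfl

/-- An ideal sheaf on a soft noncommutative toric scheme: two-sided ideals of the function rings of
the charts, such that the ideal on the smaller chart is the one generated by the ideal on the larger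
chart. -/
structure IdealSheaf where
  ideal : ∀ σ : Δ.Cone, TwoSidedIdeal (Y.ring σ)
  span_map : ∀ (τ σ : Δ.Cone) (h : τ ≤ σ),
    TwoSidedIdeal.span (Y.incl h '' (ideal σ : Set (Y.ring σ))) = ideal τ

variable {Y} (I : Y.IdealSheaf)

/-- The function ring of a closed subscheme on the chart of `σ`. -/
abbrev IdealSheaf.quotient (σ : Δ.Cone) : Type := (I.ideal σ).ringCon.Quotient

theorem IdealSheaf.le_ker {τ σ : Δ.Cone} (h : τ ≤ σ) :
    (I.ideal σ).ringCon ≤ RingCon.ker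
      ((RingCon.mk' (I.ideal τ).ringCon).comp (Y.incl h).toRingHom) := by
  intro x y hxy
  rw [RingCon.ker_apply]
  refine (RingCon.eq _).2 ?_
  rw [TwoSidedIdeal.rel_iff]
  have h1 : x - y ∈ I.ideal σ := (TwoSidedIdeal.rel_iff _ _ _).1 hxy
  have h2 : Y.incl h (x - y) ∈ I.ideal τ := by
    rw [← I.span_map τ σ h]
    exact TwoSidedIdeal.subset_span ⟨_, h1, rfl⟩
  simpa using h2

/-- The restriction maps between the function rings of a closed subscheme. -/
noncomputable def IdealSheaf.quotientMap {τ σ : Δ.Cone} (h : τ ≤ σ) :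
    I.quotient σ →ₐ[ℂ] I.quotient τ where
  __ := RingCon.lift _ _ (I.le_ker h)
  commutes' c := congrArg (RingCon.mk' (I.ideal τ).ringCon) ((Y.incl h).commutes c)

theorem IdealSheaf.quotientMap_mk {τ σ : Δ.Cone} (h : τ ≤ σ) (x : Y.ring σ) :
    I.quotientMap h (RingCon.mk' _ x) = RingCon.mk' _ (Y.incl h x) := rfl

end SoftToricScheme

/-- A soft noncommutative scheme via toric geometry: a closed subscheme of a soft noncommutative
toric scheme, given by an ideal sheaf. The zero ideal sheaf gives the toric scheme itself. -/
structure SoftScheme (Δ : Fan n) where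
  ambient : SoftToricScheme Δ
  idealSheaf : ambient.IdealSheaf

/-- The structure sheaf of a soft noncommutative scheme: the inverse system of `ℂ`-algebras indexed
by the cones of the fan. -/
noncomputable def SoftScheme.structureSheaf {Δ : Fan n} (Y : SoftScheme Δ) :
    Δ.Coneᵒᵖ ⥤ AlgCat.{0} ℂ where
  obj σ := AlgCat.of ℂ (Y.idealSheaf.quotient σ.unop)
  map f := AlgCat.ofHom (Y.idealSheaf.quotientMap f.unop.le)
  map_id σ := by
    apply AlgCat.hom_ext
    apply AlgHom.ext
    intro x
    induction x using Quotient.inductionOn' with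
    | h x => exact congrArg (RingCon.mk' _) (Y.ambient.incl_refl _ x)
  map_comp f g := by
    apply AlgCat.hom_ext
    apply AlgHom.ext
    intro x
    induction x using Quotient.inductionOn' with
    | h x => exact (congrArg (RingCon.mk' _) (Y.ambient.incl_incl _ _ x)).symm

/-! ### Homomorphisms from an inverse system of algebras to an algebra -/

section Hom

variable {A B : Type} [Ring A] [Algebra ℂ A] [Ring B] [Algebra ℂ B]

/-- The relation "`e₁` is subordinate or equal to `e₂`" for idempotents. -/
def Subordinate (e₁ e₂ : A) : Prop := e₁ * e₂ = e₁ ∧ e₂ * e₁ = e₁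

/-- Two quasi-homomorphisms (multiplicative linear maps, not required to preserve the unit)
glue under `h`. -/
structure GlueUnder {R S : Type} [Ring R] [Algebra ℂ R] [Ring S] [Algebra ℂ S] (h : R →ₐ[ℂ] S)
    (fR : R →ₙₐ[ℂ] A) (fS : S →ₙₐ[ℂ] A) : Prop where
  subordinate : Subordinate (fS 1) (fR 1)
  commute : ∀ r, Commute (fR r) (fS 1)
  left : ∀ r, fS 1 * fR r = fS (h r)
  right : ∀ r, fR r * fS 1 = fS (h r)

variable {ι : Type} [SemilatticeInf ι]

/-- `r` is the family of reduced idempotents of the family `e`: pairwise orthogonal idempotents such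
that `e σ` is the sum of the `r τ` over all `τ ≤ σ`. -/
structure IsReducedFamily (e r : ι → A) : Prop where
  idem : ∀ σ, r σ * r σ = r σ
  orthogonal : ∀ σ σ', σ ≠ σ' → r σ * r σ' = 0
  sum_eq : ∀ σ, e σ = ∑ᶠ τ ∈ Set.Iic σ, r τ

/-- A complete strong system of idempotents: products are given by meets of the indices, and the
reduced idempotents (which are unique) add up to one. -/
structure IsCompleteStrong (e : ι → A) : Prop where
  mul_eq : ∀ σ σ', e σ * e σ' = e (σ ⊓ σ')
  complete : ∃ r : ι → A, IsReducedFamily e r ∧ ∑ᶠ σ, r σ = 1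

/-- A homomorphism from an inverse system `Q` of `ℂ`-algebras to a `ℂ`-algebra `A`. -/
structure SystemHom (Q : ιᵒᵖ ⥤ AlgCat.{0} ℂ) (A : Type) [Ring A] [Algebra ℂ A] where
  hom : ∀ σ : ι, Q.obj (op σ) →ₙₐ[ℂ] A
  glue : ∀ (τ σ : ι) (h : τ < σ), GlueUnder (Q.map (homOfLE h.le).op).hom (hom σ) (hom τ)
  complete : IsCompleteStrong fun σ => hom σ 1

@[ext]
theorem SystemHom.ext {Q : ιᵒᵖ ⥤ AlgCat.{0} ℂ} {f g : SystemHom Q A}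
    (h : ∀ σ a, f.hom σ a = g.hom σ a) : f = g := by
  cases f; cases g
  congr
  funext σ
  exact NonUnitalAlgHom.ext (h σ)

/-- Post-composition of a homomorphism from an inverse system with a homomorphism of algebras. -/
def SystemHom.postcomp [Finite ι] {Q : ιᵒᵖ ⥤ AlgCat.{0} ℂ} (f : SystemHom Q A) (g : A →ₐ[ℂ] B) :
    SystemHom Q B where
  hom σ := (g : A →ₙₐ[ℂ] B).comp (f.hom σ)
  glue τ σ h := by
    have H := f.glue τ σ h
    refine ⟨⟨?_, ?_⟩, fun r => ?_, fun r => ?_, fun r => ?_⟩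
    · exact (map_mul g _ _).symm.trans (congrArg g H.subordinate.1)
    · exact (map_mul g _ _).symm.trans (congrArg g H.subordinate.2)
    · exact (H.commute r).map g
    · exact (map_mul g _ _).symm.trans (congrArg g (H.left r))
    · exact (map_mul g _ _).symm.trans (congrArg g (H.right r))
  complete := by
    obtain ⟨r, hr, hr1⟩ := f.complete.complete
    refine ⟨fun σ σ' => ?_, fun σ => g (r σ), ⟨fun σ => ?_, fun σ σ' h => ?_, fun σ => ?_⟩, ?_⟩
    · exact (map_mul g _ _).symm.trans (congrArg g (f.complete.mul_eq σ σ'))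
    · simpa using congrArg g (hr.idem σ)
    · simpa using congrArg g (hr.orthogonal σ σ' h)
    · have h1 := congrArg g (hr.sum_eq σ)
      have h2 := AddMonoidHom.map_finsum_mem (f := r) (g : A →+* B).toAddMonoidHom
        (Set.toFinite (Set.Iic σ))
      exact h1.trans h2
    · have h2 := AddMonoidHom.map_finsum (f := r) (g : A →+* B).toAddMonoidHom
        (Set.toFinite _)
      exact h2.symm.trans (by rw [hr1]; exact map_one g)

end Hom


open AlgebraicGeometry TopologicalSpace Limits

/-- The base scheme `Spec ℂ`. -/
noncomputable abbrev SpecC : Scheme.{0} := Spec (CommRingCat.of ℂ)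

/-- The structure homomorphism from `ℂ` to the functions on an open subset of a `ℂ`-scheme. -/
noncomputable def scalar (S : Over SpecC) (U : S.left.Opens) : ℂ →+* Γ(S.left, U) :=
  (S.left.presheaf.map (homOfLE le_top).op).hom.comp
    (S.hom.appTop.hom.comp (Scheme.ΓSpecIso (CommRingCat.of ℂ)).inv.hom)

theorem scalar_res (S : Over SpecC) {U V : S.left.Opens} (i : V ⟶ U) (c : ℂ) :
    S.left.presheaf.map i.op (scalar S U c) = scalar S V c := by
  have := congrArg (fun f => f.hom (S.hom.appTop.hom
    ((Scheme.ΓSpecIso (CommRingCat.of ℂ)).inv.hom c)))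
    (S.left.presheaf.map_comp (homOfLE (le_top : U ≤ ⊤)).op i.op).symm
  exact this

/-! ### The sheaf of endomorphism algebras -/

/-- The sections over `U` of the sheaf of endomorphisms of an `𝒪_X`-module `E`: the compatible
families of `Γ(X, V)`-linear endomorphisms of `Γ(E, V)`, for `V` open in `U`. -/
def endSubring (X : Over SpecC) (E : X.left.Modules) (U : X.left.Opens) :
    Subring (∀ V : Set.Iic U, Module.End Γ(X.left, V.1) Γ(E, V.1)) where
  carrier := {f | ∀ (V W : Set.Iic U) (i : W.1 ⟶ V.1) (x : Γ(E, V.1)),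
    E.presheaf.map i.op (f V x) = f W (E.presheaf.map i.op x)}
  mul_mem' := by
    intro f g hf hg V W i x
    have h1 := hf V W i (g V x)
    rw [hg V W i x] at h1
    exact h1
  one_mem' := fun V W i x => rfl
  add_mem' := by
    intro f g hf hg V W i x
    have h1 := hf V W i x
    have h2 := hg V W i x
    exact (map_add (E.presheaf.map i.op).hom _ _).trans (congrArg₂ (· + ·) h1 h2)
  zero_mem' := fun V W i x => map_zero (E.presheaf.map i.op).hom
  neg_mem' := by
    intro f hf V W i x
    exact (map_neg (E.presheaf.map i.op).hom _).trans (congrArg Neg.neg (hf V W i x))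

/-- The endomorphism algebra of the restriction of `E` to `U`. -/
def EndSections (X : Over SpecC) (E : X.left.Modules) (U : X.left.Opens) : Type :=
  endSubring X E U

noncomputable instance (X : Over SpecC) (E : X.left.Modules) (U : X.left.Opens) :
    Ring (EndSections X E U) := inferInstanceAs (Ring (endSubring X E U))

/-- A section of the endomorphism sheaf over `U` acts on the sections of `E` over an open subset
of `U`. -/
def EndSections.app {X : Over SpecC} {E : X.left.Modules} {U : X.left.Opens}
    (f : EndSections X E U) (V : X.left.Opens) (h : V ≤ U) :
    Module.End Γ(X.left, V) Γ(E, V) := f.1 ⟨V, h⟩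

theorem EndSections.ext {X : Over SpecC} {E : X.left.Modules} {U : X.left.Opens}
    {f g : EndSections X E U} (h : ∀ V hV x, f.app V hV x = g.app V hV x) : f = g :=
  Subtype.ext (funext fun V => LinearMap.ext fun x => h V.1 V.2 x)

/-- Complex numbers act on `E` through the structure morphism of `X`. -/
noncomputable def EndSections.scalarHom (X : Over SpecC) (E : X.left.Modules)
    (U : X.left.Opens) : ℂ →+* EndSections X E U where
  toFun c := ⟨fun V => scalar X V.1 c • (1 : Module.End Γ(X.left, V.1) Γ(E, V.1)), by
    intro V W i x
    change E.presheaf.map i.op (scalar X V.1 c • x) = scalar X W.1 c • E.presheaf.map i.op x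
    rw [Scheme.Modules.map_smul, scalar_res]⟩
  map_one' := EndSections.ext fun V hV x => by
    change scalar X V 1 • x = x
    rw [map_one, one_smul]
  map_mul' a b := EndSections.ext fun V hV x => by
    change scalar X V (a * b) • x = scalar X V a • scalar X V b • x
    rw [map_mul, mul_smul]
  map_zero' := EndSections.ext fun V hV x => by
    change scalar X V 0 • x = 0
    rw [map_zero, zero_smul]
  map_add' a b := EndSections.ext fun V hV x => by
    change scalar X V (a + b) • x = scalar X V a • x + scalar X V b • x
    rw [map_add, add_smul]

noncomputable instance (X : Over SpecC) (E : X.left.Modules) (U : X.left.Opens) :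
    Algebra ℂ (EndSections X E U) :=
  (EndSections.scalarHom X E U).toAlgebra' fun c f => EndSections.ext fun V hV x =>
    ((f.app V hV).map_smul (scalar X V c) x).symm

/-- Restriction of sections of the endomorphism sheaf. -/
noncomputable def EndSections.res (X : Over SpecC) (E : X.left.Modules) {U V : X.left.Opens}
    (h : V ≤ U) : EndSections X E U →ₐ[ℂ] EndSections X E V where
  toFun f := ⟨fun W => f.1 ⟨W.1, le_trans W.2 h⟩, fun V' W i x =>
    f.2 ⟨V'.1, le_trans V'.2 h⟩ ⟨W.1, le_trans W.2 h⟩ i x⟩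
  map_one' := rfl
  map_mul' _ _ := rfl
  map_zero' := rfl
  map_add' _ _ := rfl
  commutes' _ := rfl

section Morphism

variable {ι : Type} [SemilatticeInf ι] [Finite ι] (Q : ιᵒᵖ ⥤ AlgCat.{0} ℂ)

/-- The presheaf of homomorphisms from the inverse system `Q` to the endomorphism sheaf of `E`. -/
noncomputable def homPresheaf (X : Over SpecC) (E : X.left.Modules) :
    X.left.Opensᵒᵖ ⥤ Type where
  obj U := SystemHom Q (EndSections X E U.unop)
  map i := TypeCat.ofHom fun f => f.postcomp (EndSections.res X E i.unop.le)
  map_id _ := by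
    ext f
    rfl
  map_comp _ _ := by
    ext f
    rfl

/-- A morphism from the Azumaya scheme `(X, End E, E)` to the noncommutative space with structure
sheaf `Q`: a global section of the sheaf associated to the presheaf of homomorphisms. -/
def AzumayaMorphism (X : Over SpecC) (E : X.left.Modules) : Type :=
  (sheafify (Opens.grothendieckTopology X.left) (homPresheaf Q X E)).obj (op ⊤)

variable {Q}

/-- The homomorphism `f` over the open subset `U` represents the morphism `φ` on `U`. -/
def AzumayaMorphism.IsRepresentedBy {X : Over SpecC} {E : X.left.Modules}
    (φ : AzumayaMorphism Q X E) (U : X.left.Opens) (f : SystemHom Q (EndSections X E U)) : Prop :=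
  (toSheafify (Opens.grothendieckTopology X.left) (homPresheaf Q X E)).app (op U) f =
    (sheafify (Opens.grothendieckTopology X.left) (homPresheaf Q X E)).map
      (homOfLE le_top : U ⟶ ⊤).op φ

end Morphism

/-! ### Locally free modules -/

/-- The `𝒪_S`-module `M` is locally free of rank `r`. -/
def IsLocallyFreeOfRank {S : Scheme.{0}} (M : S.Modules) (r : ℕ) : Prop :=
  ∀ x : S, ∃ U : S.Opens, x ∈ U ∧
    Nonempty (M.restrict U.ι ≅ (SheafOfModules.free (Fin r) : (U : Scheme.{0}).Modules))

/-- The `𝒪_S`-module `M` is locally free of finite (not necessarily constant) rank. -/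
def IsFiniteLocallyFree {S : Scheme.{0}} (M : S.Modules) : Prop :=
  ∀ x : S, ∃ (U : S.Opens) (k : ℕ), x ∈ U ∧
    Nonempty (M.restrict U.ι ≅ (SheafOfModules.free (Fin k) : (U : Scheme.{0}).Modules))

/-! ### Modules over the structure sheaf of a product with a `ℂ`-scheme -/

/-- Multiplication by a complex number on an `𝒪_S`-module. -/
noncomputable def scalarEnd (S : Over SpecC) (M : S.left.Modules) (c : ℂ) : M ⟶ M :=
  ⟨{ app := fun U => ModuleCat.ofHom
      (X := M.val.obj U) (Y := M.val.obj U)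
      { toFun := fun x => (scalar S U.unop c • (show Γ(M, U.unop) from x) : Γ(M, U.unop))
        map_add' := fun x y => smul_add (M := Γ(S.left, U.unop)) (A := Γ(M, U.unop)) _ _ _
        map_smul' := fun a x => smul_comm (M := Γ(S.left, U.unop)) (N := Γ(S.left, U.unop))
          (α := Γ(M, U.unop)) _ _ _ }
     naturality := by
      intro U V i
      ext x
      have h : M.presheaf.map i.unop.op (scalar S U.unop c • (show Γ(M, U.unop) from x)) =
          scalar S V.unop c • M.presheaf.map i.unop.op (show Γ(M, U.unop) from x) := by
        rw [Scheme.Modules.map_smul, scalar_res]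
      exact h.symm }⟩

theorem scalarEnd_app (S : Over SpecC) (M : S.left.Modules) (c : ℂ) (U : S.left.Opens)
    (x : Γ(M, U)) : (scalarEnd S M c).app U x = scalar S U c • x := rfl

theorem scalarEnd_naturality (S : Over SpecC) {M N : S.left.Modules} (f : M ⟶ N) (c : ℂ) :
    scalarEnd S M c ≫ f = f ≫ scalarEnd S N c := by
  ext U x
  exact Scheme.Modules.Hom.app_smul f _ x

theorem scalar_comp {S T : Over SpecC} (f : T ⟶ S) (U : S.left.Opens) (c : ℂ) :
    f.left.app U (scalar S U c) = scalar T (f.left ⁻¹ᵁ U) c := by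
  have h : T.hom.appTop = S.hom.appTop ≫ f.left.appTop := by
    rw [← Over.w f, Scheme.Hom.comp_appTop]
  have h2 := f.left.naturality (homOfLE (le_top : U ≤ ⊤)).op
  have h3 := congrArg (fun g => g.hom (S.hom.appTop.hom
    ((Scheme.ΓSpecIso (CommRingCat.of ℂ)).inv.hom c))) h2
  refine h3.trans ?_
  change _ = T.left.presheaf.map _ (T.hom.appTop.hom
    ((Scheme.ΓSpecIso (CommRingCat.of ℂ)).inv.hom c))
  rw [h]
  rfl

theorem pushforward_scalarEnd {S T : Over SpecC} (f : T ⟶ S) (M : T.left.Modules) (c : ℂ) :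
    (Scheme.Modules.pushforward f.left).map (scalarEnd T M c) =
      scalarEnd S ((Scheme.Modules.pushforward f.left).obj M) c := by
  ext U x
  have h : scalar T (f.left ⁻¹ᵁ U) c • (show Γ(M, f.left ⁻¹ᵁ U) from x) =
      f.left.app U (scalar S U c) • (show Γ(M, f.left ⁻¹ᵁ U) from x) := by
    rw [scalar_comp]
  exact h

theorem pullback_scalarEnd {S T : Over SpecC} (f : T ⟶ S) (M : S.left.Modules) (c : ℂ) :
    (Scheme.Modules.pullback f.left).map (scalarEnd S M c) =
      scalarEnd T ((Scheme.Modules.pullback f.left).obj M) c := by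
  apply ((Scheme.Modules.pullbackPushforwardAdjunction f.left).homEquiv _ _).injective
  rw [Adjunction.homEquiv_unit, Adjunction.homEquiv_unit, pushforward_scalarEnd]
  exact ((Scheme.Modules.pullbackPushforwardAdjunction f.left).unit.naturality
    (scalarEnd S M c)).symm.trans (scalarEnd_naturality S
      ((Scheme.Modules.pullbackPushforwardAdjunction f.left).unit.app M) c)


section Modules

variable {ι : Type} [PartialOrder ι] (Q : ιᵒᵖ ⥤ AlgCat.{0} ℂ)

/-- A left module over the structure sheaf of the product of the `ℂ`-scheme `S` with the
noncommutative space with structure sheaf `Q`: an inverse system of `𝒪_S`-modules `F_σ`, each with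
a left `𝒪_S ⊗ Q_σ`-module structure, that is, an action of the `ℂ`-algebra `Q_σ` by
`𝒪_S`-linear endomorphisms, and with transition maps `F_σ ⟶ F_τ` for `τ ≤ σ` which are linear over
`Q_σ ⟶ Q_τ`; equivalently, with maps `Q_τ ⊗_{Q_σ} F_σ ⟶ F_τ` of modules over `Q_τ`. -/
structure ProductModule (S : Over SpecC) where
  system : ιᵒᵖ ⥤ S.left.Modules
  act : ∀ σ : ιᵒᵖ, Q.obj σ →+* End (system.obj σ)
  act_algebraMap : ∀ (σ : ιᵒᵖ) (c : ℂ),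
    act σ (algebraMap ℂ (Q.obj σ) c) = scalarEnd S (system.obj σ) c
  act_map : ∀ {σ τ : ιᵒᵖ} (i : σ ⟶ τ) (a : Q.obj σ),
    (act σ a : system.obj σ ⟶ system.obj σ) ≫ system.map i =
      system.map i ≫ act τ ((Q.map i).hom a)

namespace ProductModule

variable {Q} {S T W : Over SpecC}

/-- A homomorphism of modules over the structure sheaf of a product. -/
@[ext]
structure Hom (F G : ProductModule Q S) where
  hom : F.system ⟶ G.system
  act_hom : ∀ (σ : ιᵒᵖ) (a : Q.obj σ),
    (F.act σ a : F.system.obj σ ⟶ F.system.obj σ) ≫ hom.app σ = hom.app σ ≫ G.act σ a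

noncomputable instance : Category (ProductModule Q S) where
  Hom := Hom
  id F := ⟨𝟙 _, fun σ a => by simp⟩
  comp f g := ⟨f.hom ≫ g.hom, fun σ a => by
    rw [NatTrans.comp_app, ← Category.assoc, f.act_hom, Category.assoc, g.act_hom,
      Category.assoc]⟩

theorem hom_ext {F G : ProductModule Q S} {f g : F ⟶ G}
    (h : ∀ σ, f.hom.app σ = g.hom.app σ) : f = g :=
  Hom.ext (NatTrans.ext (funext h))

/-- The pullback of a module along a morphism of `ℂ`-schemes. -/
noncomputable def pullbackObj (f : T ⟶ S) (F : ProductModule Q S) : ProductModule Q T where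
  system := F.system ⋙ Scheme.Modules.pullback f.left
  act σ :=
    { toFun := fun a => (Scheme.Modules.pullback f.left).map (F.act σ a)
      map_one' := by
        rw [map_one]
        exact (Scheme.Modules.pullback f.left).map_id _
      map_mul' := fun a b => by
        rw [map_mul]
        exact (Scheme.Modules.pullback f.left).map_comp _ _
      map_zero' := by
        rw [map_zero]
        exact (Scheme.Modules.pullback f.left).map_zero _ _
      map_add' := fun a b => by
        rw [map_add]
        exact (Scheme.Modules.pullback f.left).map_add }
  act_algebraMap σ c := by
    change (Scheme.Modules.pullback f.left).map (F.act σ (algebraMap ℂ (Q.obj σ) c)) = _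
    rw [F.act_algebraMap]
    exact pullback_scalarEnd f _ c
  act_map i a := by
    change (Scheme.Modules.pullback f.left).map _ ≫ (Scheme.Modules.pullback f.left).map _ =
      (Scheme.Modules.pullback f.left).map _ ≫ (Scheme.Modules.pullback f.left).map _
    rw [← Functor.map_comp, ← Functor.map_comp, F.act_map]

/-- The pullback functor along a morphism of `ℂ`-schemes. -/
noncomputable def pullback (f : T ⟶ S) : ProductModule Q S ⥤ ProductModule Q T where
  obj := pullbackObj f
  map α := ⟨Functor.whiskerRight α.hom _, fun σ a => by
    change (Scheme.Modules.pullback f.left).map _ ≫ (Scheme.Modules.pullback f.left).map _ =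
      (Scheme.Modules.pullback f.left).map _ ≫ (Scheme.Modules.pullback f.left).map _
    rw [← Functor.map_comp, ← Functor.map_comp, α.act_hom]⟩
  map_id F := hom_ext fun σ => (Scheme.Modules.pullback f.left).map_id _
  map_comp α β := hom_ext fun σ => (Scheme.Modules.pullback f.left).map_comp _ _

/-- An isomorphism of modules from compatible isomorphisms of the components. -/
noncomputable def isoMk {F G : ProductModule Q S} (e : ∀ σ, F.system.obj σ ≅ G.system.obj σ)
    (nat : ∀ {σ τ : ιᵒᵖ} (i : σ ⟶ τ),
      F.system.map i ≫ (e τ).hom = (e σ).hom ≫ G.system.map i)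
    (act : ∀ (σ : ιᵒᵖ) (a : Q.obj σ),
      (F.act σ a : F.system.obj σ ⟶ F.system.obj σ) ≫ (e σ).hom = (e σ).hom ≫ G.act σ a) :
    F ≅ G where
  hom := ⟨{ app := fun σ => (e σ).hom, naturality := fun _ _ i => nat i }, act⟩
  inv :=
    { hom :=
        { app := fun σ => (e σ).inv
          naturality := by
            intro σ τ i
            rw [Iso.comp_inv_eq, Category.assoc, nat, Iso.inv_hom_id_assoc] }
      act_hom := by
        intro σ a
        rw [Iso.comp_inv_eq, Category.assoc, act, Iso.inv_hom_id_assoc] }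
  hom_inv_id := hom_ext fun σ => (e σ).hom_inv_id
  inv_hom_id := hom_ext fun σ => (e σ).inv_hom_id

/-- Pullback along the identity. -/
noncomputable def pullbackId (F : ProductModule Q S) : (pullback (𝟙 S)).obj F ≅ F :=
  isoMk (fun σ => (Scheme.Modules.pullbackId S.left).app (F.system.obj σ))
    (fun i => (Scheme.Modules.pullbackId S.left).hom.naturality (F.system.map i))
    (fun σ a => (Scheme.Modules.pullbackId S.left).hom.naturality (F.act σ a))

/-- Pullback along a composition. -/
noncomputable def pullbackComp (g : W ⟶ T) (f : T ⟶ S) (F : ProductModule Q S) :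
    (pullback (g ≫ f)).obj F ≅ (pullback g).obj ((pullback f).obj F) :=
  isoMk (fun σ => (Scheme.Modules.pullbackComp g.left f.left).symm.app (F.system.obj σ))
    (fun i => (Scheme.Modules.pullbackComp g.left f.left).inv.naturality (F.system.map i))
    (fun σ a => (Scheme.Modules.pullbackComp g.left f.left).inv.naturality (F.act σ a))

/-- The direct image of a module to `S`: the sheaf of compatible families of sections, that is, the
limit of the inverse system. -/
noncomputable def directImage (F : ProductModule Q S) : S.left.Modules := limit F.system

/-- The module `F` is a flat family over `S` of `0`-dimensional modules of dimension `r`: after every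
base change, its components are locally free of finite rank over the base and its direct image to
the base is locally free of rank `r`. -/
def IsFamily (r : ℕ) (F : ProductModule Q S) : Prop :=
  ∀ (T : Over SpecC) (f : T ⟶ S),
    (∀ σ : ιᵒᵖ, IsFiniteLocallyFree (((pullback f).obj F).system.obj σ)) ∧
      IsLocallyFreeOfRank ((pullback f).obj F).directImage r

end ProductModule

theorem IsLocallyFreeOfRank.of_iso {S : Scheme.{0}} {M N : S.Modules} (e : M ≅ N) {r : ℕ}
    (h : IsLocallyFreeOfRank M r) : IsLocallyFreeOfRank N r := by
  intro x
  obtain ⟨U, hx, ⟨i⟩⟩ := h x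
  exact ⟨U, hx, ⟨((Scheme.Modules.restrictFunctor U.ι).mapIso e).symm ≪≫ i⟩⟩

theorem IsFiniteLocallyFree.of_iso {S : Scheme.{0}} {M N : S.Modules} (e : M ≅ N)
    (h : IsFiniteLocallyFree M) : IsFiniteLocallyFree N := by
  intro x
  obtain ⟨U, k, hx, ⟨i⟩⟩ := h x
  exact ⟨U, k, hx, ⟨((Scheme.Modules.restrictFunctor U.ι).mapIso e).symm ≪≫ i⟩⟩

namespace ProductModule

variable {Q} {S T W : Over SpecC}

/-- The isomorphism of inverse systems underlying an isomorphism of modules. -/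
noncomputable def systemIso {F G : ProductModule Q S} (e : F ≅ G) : F.system ≅ G.system where
  hom := e.hom.hom
  inv := e.inv.hom
  hom_inv_id := congrArg Hom.hom e.hom_inv_id
  inv_hom_id := congrArg Hom.hom e.inv_hom_id

theorem IsFamily.pullback {r : ℕ} {F : ProductModule Q S} (h : F.IsFamily r) (f : T ⟶ S) :
    ((ProductModule.pullback f).obj F).IsFamily r := by
  intro W g
  have e := systemIso (pullbackComp g f F)
  obtain ⟨h1, h2⟩ := h W (g ≫ f)
  exact ⟨fun σ => (h1 σ).of_iso (e.app σ), h2.of_iso (HasLimit.isoOfNatIso e)⟩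

end ProductModule

/-! ### The moduli stack -/

/-- Flat families over `S` of `0`-dimensional modules of dimension `r`. -/
structure Family (r : ℕ) (S : Over SpecC) where
  module : ProductModule Q S
  isFamily : module.IsFamily r

namespace Family

variable {Q} {r : ℕ} {S T W : Over SpecC}

/-- Families over `S` form a groupoid: the morphisms are the isomorphisms of modules. -/
noncomputable instance : Groupoid (Family Q r S) where
  Hom F G := F.module ≅ G.module
  id F := Iso.refl F.module
  comp e e' := e ≪≫ e'
  id_comp _ := Iso.refl_trans _
  comp_id _ := Iso.trans_refl _
  assoc _ _ _ := Iso.trans_assoc _ _ _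
  inv e := e.symm
  inv_comp e := e.symm_self_id
  comp_inv e := e.self_symm_id

/-- The pullback of families along a morphism of `ℂ`-schemes. -/
noncomputable def pullback (f : T ⟶ S) : Family Q r S ⥤ Family Q r T where
  obj F := ⟨(ProductModule.pullback f).obj F.module, F.isFamily.pullback f⟩
  map e := (ProductModule.pullback f).mapIso e
  map_id F := (ProductModule.pullback f).mapIso_refl F.module
  map_comp e e' := (ProductModule.pullback f).mapIso_trans e e'

/-- Pullback of families along the identity. -/
noncomputable def pullbackId (S : Over SpecC) : pullback (𝟙 S) ≅ 𝟭 (Family Q r S) :=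
  NatIso.ofComponents
    (fun F =>
      { hom := F.module.pullbackId
        inv := F.module.pullbackId.symm
        hom_inv_id := Iso.self_symm_id _
        inv_hom_id := Iso.symm_self_id _ })
    (fun e => Iso.ext (ProductModule.hom_ext fun σ =>
      (Scheme.Modules.pullbackId S.left).hom.naturality (e.hom.hom.app σ)))

/-- Pullback of families along a composition. -/
noncomputable def pullbackComp (g : W ⟶ T) (f : T ⟶ S) :
    pullback (g ≫ f) ≅ pullback f ⋙ (pullback g : Family Q r T ⥤ Family Q r W) :=
  NatIso.ofComponents
    (fun F =>
      { hom := F.module.pullbackComp g f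
        inv := (F.module.pullbackComp g f).symm
        hom_inv_id := Iso.self_symm_id _
        inv_hom_id := Iso.symm_self_id _ })
    (fun e => Iso.ext (ProductModule.hom_ext fun σ =>
      (Scheme.Modules.pullbackComp g.left f.left).inv.naturality (e.hom.hom.app σ)))

/-- The components of an isomorphism of families. -/
noncomputable def component {F G : Family Q r S} (e : F ⟶ G) (σ : ιᵒᵖ) :
    F.module.system.obj σ ⟶ G.module.system.obj σ :=
  (Iso.hom (C := ProductModule Q S) e).hom.app σ

theorem hom_ext {F G : Family Q r S} {e e' : F ⟶ G}
    (h : ∀ σ, component e σ = component e' σ) : e = e' :=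
  Iso.ext (ProductModule.hom_ext h)

theorem eq_eqToHom {u v : Cat.of (Family Q r S) ⟶ Cat.of (Family Q r T)} (h : u = v) (α : u ⟶ v)
    (H : ∀ (F : Family Q r S) (σ : ιᵒᵖ), component (α.toNatTrans.app F) σ =
      eqToHom (congrArg (fun w : Cat.of (Family Q r S) ⟶ Cat.of (Family Q r T) =>
        (w.toFunctor.obj F).module.system.obj σ) h)) : α = eqToHom h := by
  subst h
  apply Cat.Hom₂.ext
  apply NatTrans.ext
  funext F
  exact hom_ext fun σ => H F σ

/-- The pseudofunctor which sends a `ℂ`-scheme `S` to the groupoid of families over `S`. -/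
noncomputable def pseudofunctor (Q : ιᵒᵖ ⥤ AlgCat.{0} ℂ) (r : ℕ) :
    Pseudofunctor (LocallyDiscrete (Over SpecC)ᵒᵖ) Cat :=
  LocallyDiscrete.mkPseudofunctor
    (fun S => Cat.of (Family Q r S.unop))
    (fun f => (pullback f.unop).toCatHom)
    (fun S => Cat.Hom.isoMk (pullbackId S.unop))
    (fun f g => Cat.Hom.isoMk (pullbackComp g.unop f.unop))
    (by
      intro a b c d f g h
      refine eq_eqToHom _ _ fun F σ => ?_
      have H := congrArg (fun t => t.app (F.module.system.obj σ))
        (Scheme.Modules.pseudofunctor_associativity h.unop.left g.unop.left f.unop.left)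
      simp only [CategoryTheory.eqToHom_app] at H
      exact H)
    (by
      intro a b f
      refine eq_eqToHom _ _ fun F σ => ?_
      have H := congrArg (fun t => t.app (F.module.system.obj σ))
        (Scheme.Modules.pseudofunctor_left_unitality f.unop.left)
      simp only [CategoryTheory.eqToHom_app] at H
      exact H)
    (by
      intro a b f
      refine eq_eqToHom _ _ fun F σ => ?_
      have H := congrArg (fun t => t.app (F.module.system.obj σ))
        (Scheme.Modules.pseudofunctor_right_unitality f.unop.left)
      simp only [CategoryTheory.eqToHom_app] at H
      exact H)

end Family

/-- The moduli stack of `0`-dimensional modules of dimension `r` over the noncommutative space with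
structure sheaf `Q`, as a category fibered in groupoids over the category of `ℂ`-schemes: an object
over `S` is a family over `S`, and a morphism from `F` over `S` to `G` over `T` is a morphism
`f : S ⟶ T` with an isomorphism from `F` to the pullback of `G` along `f`. -/
noncomputable def moduliStack (r : ℕ) : BasedCategory (Over SpecC) :=
  BasedCategory.ofFunctor (Pseudofunctor.CoGrothendieck.forget (Family.pseudofunctor Q r))

/-- The object of the moduli stack given by a family. -/
noncomputable def moduliStack.point {r : ℕ} {S : Over SpecC} (F : Family Q r S) :
    (moduliStack Q r).obj :=
  (⟨S, F⟩ : Pseudofunctor.CoGrothendieck (Family.pseudofunctor Q r))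

/-- A `ℂ`-scheme, as a category fibered in groupoids over the category of `ℂ`-schemes. -/
noncomputable def schemeStack (X : Over SpecC) : BasedCategory (Over SpecC) :=
  BasedCategory.ofFunctor (Over.forget X)

/-- The object `𝟙 X` of the category fibered in groupoids which is associated to `X`. -/
noncomputable def schemeStack.tautological (X : Over SpecC) : (schemeStack X).obj :=
  (Over.mk (𝟙 X) : Over X)

variable {Q}

/-- The morphism `Φ` from `X` to the moduli stack classifies the family `F` over `X`: the value of
`Φ` at the tautological object is isomorphic to `F` over the identity of `X`. -/
def Classifies {r : ℕ} {X : Over SpecC} (Φ : BasedFunctor (schemeStack X) (moduliStack Q r))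
    (F : Family Q r X) : Prop :=
  ∃ β : Φ.obj (schemeStack.tautological X) ≅ moduliStack.point Q F,
    (moduliStack Q r).p.IsHomLift (𝟙 X) β.hom

end Modules

/-! ### The graph of a morphism -/

/-- `F` is the graph of the morphism `φ` from the Azumaya scheme `(X, End E, E)`: the direct image of
`E` to the product of `X` with the target. Its component at `σ` is the direct summand `e_σ E`, where
`e_σ` is the image of `1` in `End E`, on which a function `a` on the chart of `σ` acts through its
image in `End E`; the transition map for `τ ≤ σ` is the projection `e_σ E ⟶ e_τ E`. -/
def IsGraph {ι : Type} [SemilatticeInf ι] [Finite ι] {Q : ιᵒᵖ ⥤ AlgCat.{0} ℂ} {X : Over SpecC}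
    {E : X.left.Modules} (φ : AzumayaMorphism Q X E) (F : ProductModule Q X) : Prop :=
  ∃ (i : ∀ σ : ιᵒᵖ, F.system.obj σ ⟶ E) (p : ∀ σ : ιᵒᵖ, E ⟶ F.system.obj σ),
    (∀ σ, i σ ≫ p σ = 𝟙 _) ∧
    (∀ (σ τ : ιᵒᵖ) (h : σ ⟶ τ), F.system.map h = i σ ≫ p τ) ∧
    ∀ (U : X.left.Opens) (f : SystemHom Q (EndSections X E U)), φ.IsRepresentedBy U f →
      ∀ (σ : ιᵒᵖ) (a : Q.obj σ) (V : X.left.Opens) (hV : V ≤ U) (x : Γ(E, V)),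
        (p σ ≫ F.act σ a ≫ i σ).app V x = (f.hom σ.unop a).app V hV x

end SoftNC

open SoftNC

/-!
The presheaf of homomorphisms from the structure sheaf of the target to the endomorphisms of `E` is
already a sheaf (`isSheaf_homPresheaf`): the actions glue because endomorphisms do, and the reduced
idempotents glue because the actions determine them, by induction over the poset of cones
(`IsReducedFamily.unique`). So the morphism `φ` is a single global homomorphism `f` to `End E`
(`AzumayaMorphism.exists_global`).

The category of modules is idempotent complete, so that each `e_σ = f_σ 1` splits as the projection
to a direct summand `e_σ E`, and these summands form the graph (`SystemHom.graph`). The reduced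
idempotents `r_τ` add up to `1`, and `e_σ r_τ` is `r_τ` or `0` according to whether `τ ≤ σ`. Hence a
compatible family `(x_σ)` in the summands comes from the one section `∑ r_τ x_τ` of `E`, which is to
say that `E` is the limit of the graph (`IsPartition.nonempty_isLimit`). This argument uses only
equations between endomorphisms of `E`, so it persists after any additive functor is applied; with
the pullback along `T ⟶ X` it shows that the direct image commutes with base change, although
pullbacks do not preserve limits in general (`SystemHom.nonempty_limit_graph_iso`).

The components of the graph are locally free because a direct summand of a free module of finite
rank is the image of an idempotent matrix `P`, and near a given point `P` is conjugate to a diagonal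
matrix with entries `0` and `1`: columns of `P` and of `1 - P` which form a basis of the fiber at the
point are the columns of an invertible matrix on a neighborhood
(`exists_diagonalization_of_idempotent`, `IsLocallyFreeOfRank.isFiniteLocallyFree_of_summand`).

The classifying morphism is an instance of the 2-Yoneda lemma (`exists_classifies`): it sends
`g : T ⟶ X` to the pullback of the graph along `g`. All arrows of the moduli stack are strongly
cartesian, since its fibers are groupoids, and this determines a morphism from `X` by its value at
`𝟙 X` up to isomorphism.
-/

namespace SoftNC

/-! ### Categories fibered in groupoids -/

section FiberedInGroupoids

variable {𝒮 : Type*} [Category* 𝒮]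

/-- A category fibered in groupoids has only strongly cartesian arrows; for the Grothendieck
construction this follows from the invertibility of the arrows of the fibers. -/
theorem isStronglyCartesian_of_groupoid (F : Pseudofunctor (LocallyDiscrete 𝒮ᵒᵖ) Cat)
    (hF : ∀ (S : 𝒮) {a b : F.obj ⟨op S⟩} (f : a ⟶ b), IsIso f)
    {a b : Pseudofunctor.CoGrothendieck F} {R S : 𝒮} (f : R ⟶ S) (φ : a ⟶ b)
    [h : (Pseudofunctor.CoGrothendieck.forget F).IsHomLift f φ] :
    (Pseudofunctor.CoGrothendieck.forget F).IsStronglyCartesian f φ := by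
  let p := Pseudofunctor.CoGrothendieck.forget F
  have hb : p.obj b = S := IsHomLift.codomain_eq p f φ
  let c := Functor.IsPreFibered.pullbackMap hb f
  have h1 : p.IsHomLift (𝟙 R ≫ f) φ := by simpa using (inferInstance : p.IsHomLift f φ)
  let v := Functor.IsCartesian.map p f c φ
  have hv : v ≫ c = φ := Functor.IsCartesian.fac p f c φ
  let w := Functor.Fiber.homMk p R v
  have hw : IsIso w := by
    let G := (Functor.Fiber.inducedFunctor (Pseudofunctor.CoGrothendieck.comp_const F R)).inv
    have : IsIso (G.map w) := hF R _
    exact isIso_of_reflects_iso w G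
  have hv' : IsIso v := by
    have : IsIso (Functor.Fiber.fiberInclusion.map w) := inferInstance
    exact this
  have : p.IsCartesian f ((asIso v).hom ≫ c) := by
    have : p.IsHomLift (𝟙 R) (asIso v).hom := inferInstanceAs (p.IsHomLift (𝟙 R) v)
    infer_instance
  have h2 : p.IsCartesian f φ := by rw [← hv]; exact this
  exact Functor.IsFibered.isStronglyCartesian_of_isCartesian p f φ

end FiberedInGroupoids

/-! ### The 2-Yoneda lemma -/

section TwoYoneda

open Functor

variable {𝒮 : Type*} [Category* 𝒮] {𝒴 : BasedCategory 𝒮} {X : 𝒮} {ξ : 𝒴.obj}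

/-- The functor which sends `f` to `c f`, for a choice of strongly cartesian lifts `φ f : c f ⟶ ξ` of
the morphisms `f` to `X`. -/
noncomputable def functorOfLifts (c : Over X → 𝒴.obj) (φ : ∀ f : Over X, c f ⟶ ξ)
    [hφ : ∀ f : Over X, 𝒴.p.IsStronglyCartesian (R := f.left) (S := X) f.hom (φ f)] :
    Over X ⥤ 𝒴.obj where
  obj f := c f
  map {f g} k := IsStronglyCartesian.map 𝒴.p (R := g.left) (S := X) g.hom (φ g) (Over.w k).symm
    (φ f)
  map_id f := by
    have : 𝒴.p.IsHomLift (𝟙 f.left) (𝟙 (c f)) :=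
      IsHomLift.id (IsHomLift.domain_eq 𝒴.p (R := f.left) (S := X) f.hom (φ f))
    exact (IsStronglyCartesian.map_uniq 𝒴.p (R := f.left) (S := X) f.hom (φ f)
      (g := 𝟙 f.left) _ (φ f) (𝟙 (c f)) (by simp)).symm
  map_comp {f g h} k l := by
    refine (IsStronglyCartesian.map_uniq 𝒴.p (R := h.left) (S := X) h.hom (φ h)
      (g := k.left ≫ l.left) _ (φ f) _ ?_).symm
    simp

/-- The morphism from `X` to a fibered category which a choice of strongly cartesian lifts of the
morphisms to `X` determines. -/
noncomputable def basedFunctorOfLifts (c : Over X → 𝒴.obj) (φ : ∀ f : Over X, c f ⟶ ξ)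
    [hφ : ∀ f : Over X, 𝒴.p.IsStronglyCartesian (R := f.left) (S := X) f.hom (φ f)] :
    BasedFunctor (BasedCategory.ofFunctor (Over.forget X)) 𝒴 where
  toFunctor := functorOfLifts c φ
  w := by
    have h : functorOfLifts c φ ⋙ 𝒴.p = Over.forget X := by
      have hd (f : Over X) : 𝒴.p.obj (c f) = f.left :=
        IsHomLift.domain_eq 𝒴.p (R := f.left) (S := X) f.hom (φ f)
      refine CategoryTheory.Functor.ext hd fun f g k => ?_
      exact IsHomLift.fac' 𝒴.p k.left (IsStronglyCartesian.map 𝒴.p (R := g.left) (S := X)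
        g.hom (φ g) (Over.w k).symm (φ f))
    exact h

/-- The arrow to `ξ` over `f` which a morphism `Φ` from `X` to a fibered category determines, given
an arrow `α` from its value at `𝟙 X` to `ξ`. -/
noncomputable def toPoint (Φ : BasedFunctor (BasedCategory.ofFunctor (Over.forget X)) 𝒴)
    (α : Φ.obj (Over.mk (𝟙 X) : Over X) ⟶ ξ) (f : Over X) : Φ.obj f ⟶ ξ :=
  Φ.map (Over.homMk f.hom : f ⟶ Over.mk (𝟙 X)) ≫ α

theorem map_toPoint (Φ : BasedFunctor (BasedCategory.ofFunctor (Over.forget X)) 𝒴)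
    (α : Φ.obj (Over.mk (𝟙 X) : Over X) ⟶ ξ) {f g : Over X} (k : f ⟶ g) :
    Φ.map k ≫ toPoint Φ α g = toPoint Φ α f := by
  have h : k ≫ (Over.homMk g.hom : g ⟶ Over.mk (𝟙 X)) = Over.homMk f.hom := by
    ext
    simp
  unfold toPoint
  rw [← Category.assoc, ← h]
  congr 1
  exact (Φ.map_comp (X := f) (Y := g) (Z := (Over.mk (𝟙 X) : Over X)) k _).symm

theorem isHomLift_map (Φ : BasedFunctor (BasedCategory.ofFunctor (Over.forget X)) 𝒴)
    {f g : Over X} (k : f ⟶ g) : 𝒴.p.IsHomLift k.left (Φ.map k) := by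
  have : (BasedCategory.ofFunctor (Over.forget X)).p.IsHomLift k.left k :=
    IsHomLift.map (Over.forget X) k
  exact BasedFunctor.preserves_isHomLift Φ k.left k

theorem isHomLift_toPoint (Φ : BasedFunctor (BasedCategory.ofFunctor (Over.forget X)) 𝒴)
    (α : Φ.obj (Over.mk (𝟙 X) : Over X) ⟶ ξ) [𝒴.p.IsHomLift (𝟙 X) α] (f : Over X) :
    𝒴.p.IsHomLift f.hom (toPoint Φ α f) := by
  have h : 𝒴.p.IsHomLift f.hom (Φ.map (Over.homMk f.hom : f ⟶ Over.mk (𝟙 X))) :=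
    isHomLift_map Φ (Over.homMk f.hom : f ⟶ Over.mk (𝟙 X))
  exact IsHomLift.comp_lift_id_right' 𝒴.p f.hom _ X α

/-- Two morphisms from `X` to a category fibered in groupoids are isomorphic if their values at
`𝟙 X` are isomorphic to the same object over the identity. -/
theorem nonempty_iso_of_lifts
    (hcart : ∀ {a b : 𝒴.obj} {R S : 𝒮} (f : R ⟶ S) (φ : a ⟶ b) [𝒴.p.IsHomLift f φ],
      𝒴.p.IsStronglyCartesian f φ)
    (Φ Ψ : BasedFunctor (BasedCategory.ofFunctor (Over.forget X)) 𝒴)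
    (α : Φ.obj (Over.mk (𝟙 X) : Over X) ⟶ ξ) (hα : 𝒴.p.IsHomLift (𝟙 X) α)
    (β : Ψ.obj (Over.mk (𝟙 X) : Over X) ⟶ ξ) (hβ : 𝒴.p.IsHomLift (𝟙 X) β) : Nonempty (Φ ≅ Ψ) := by
  have hα := isHomLift_toPoint Φ α
  have hβ := isHomLift_toPoint Ψ β
  have hα' := fun f : Over X => hcart (R := f.left) (S := X) f.hom (toPoint Φ α f)
  have hβ' := fun f : Over X => hcart (R := f.left) (S := X) f.hom (toPoint Ψ β f)
  let e : ∀ f : Over X, Φ.obj f ≅ Ψ.obj f := fun f =>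
    IsCartesian.domainUniqueUpToIso 𝒴.p f.hom (toPoint Ψ β f) (toPoint Φ α f)
  have he : ∀ f, (e f).hom ≫ toPoint Ψ β f = toPoint Φ α f := fun f =>
    IsCartesian.fac 𝒴.p f.hom (toPoint Ψ β f) (toPoint Φ α f)
  have hl : ∀ f : Over X, 𝒴.p.IsHomLift (𝟙 f.left) (e f).hom := fun f =>
    IsCartesian.map_isHomLift 𝒴.p f.hom (toPoint Ψ β f) (toPoint Φ α f)
  have nat : ∀ {f g : Over X} (k : f ⟶ g), Φ.map k ≫ (e g).hom = (e f).hom ≫ Ψ.map k := by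
    intro f g k
    have h1 := isHomLift_map Φ k
    have h2 := isHomLift_map Ψ k
    have h3 : 𝒴.p.IsHomLift k.left (Φ.map k ≫ (e g).hom) :=
      IsHomLift.comp_lift_id_right' 𝒴.p _ _ g.left _
    have h4 : 𝒴.p.IsHomLift k.left ((e f).hom ≫ Ψ.map k) :=
      IsHomLift.comp_lift_id_left' 𝒴.p f.left _ _ _
    apply IsStronglyCartesian.ext 𝒴.p (R := g.left) (S := X) g.hom (toPoint Ψ β g) k.left
    rw [Category.assoc, Category.assoc, he g, map_toPoint Ψ β k, he f, map_toPoint Φ α k]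
  exact ⟨BasedNatIso.mkNatIso (NatIso.ofComponents e nat) fun f => hl f⟩

end TwoYoneda

section

variable {ι : Type} [PartialOrder ι] (Q : ιᵒᵖ ⥤ AlgCat.{0} ℂ) (r : ℕ)

theorem moduliStack_isStronglyCartesian {a b : (moduliStack Q r).obj} {R S : Over SpecC}
    (f : R ⟶ S) (φ : a ⟶ b) [h : (moduliStack Q r).p.IsHomLift f φ] :
    (moduliStack Q r).p.IsStronglyCartesian f φ :=
  isStronglyCartesian_of_groupoid (Family.pseudofunctor Q r)
    (fun S a b f => @IsIso.of_groupoid (Family Q r S) _ a b f) f φ (h := h)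

variable {Q r}

/-- Every family over `X` is classified by a morphism from `X` to the moduli stack, which is unique
up to isomorphism. -/
theorem exists_classifies {X : Over SpecC} (F : Family Q r X) :
    ∃ Φ : BasedFunctor (schemeStack X) (moduliStack Q r), Classifies Φ F ∧
      ∀ Φ' : BasedFunctor (schemeStack X) (moduliStack Q r),
        Classifies Φ' F → Nonempty (Φ ≅ Φ') := by
  let c : Over X → (moduliStack Q r).obj := fun f =>
    Pseudofunctor.CoGrothendieck.domainCartesianLift (F := Family.pseudofunctor Q r) F f.hom
  let φ : ∀ f : Over X, c f ⟶ moduliStack.point Q F := fun f =>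
    Pseudofunctor.CoGrothendieck.cartesianLift (F := Family.pseudofunctor Q r) F f.hom
  have key (f : Over X) :
      (moduliStack Q r).p.IsStronglyCartesian (R := f.left) (S := X) f.hom (φ f) :=
    Pseudofunctor.CoGrothendieck.isStronglyCartesian_homCartesianLift
      (F := Family.pseudofunctor Q r) F f.hom
  let Φ : BasedFunctor (schemeStack X) (moduliStack Q r) := basedFunctorOfLifts c φ
  have h1 : (moduliStack Q r).p.IsStronglyCartesian (𝟙 X) (φ (Over.mk (𝟙 X))) :=
    key (Over.mk (𝟙 X))
  have h2 : IsIso (φ (Over.mk (𝟙 X))) :=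
    Functor.IsStronglyCartesian.isIso_of_base_isIso (moduliStack Q r).p (𝟙 X) _
  let e : c (Over.mk (𝟙 X)) ≅ moduliStack.point Q F := asIso (φ (Over.mk (𝟙 X)))
  have hΦ : Classifies Φ F := ⟨e, h1.toIsHomLift⟩
  refine ⟨Φ, hΦ, fun Φ' hΦ' => ?_⟩
  obtain ⟨β, hβ⟩ := hΦ
  obtain ⟨β', hβ'⟩ := hΦ'
  exact nonempty_iso_of_lifts (moduliStack_isStronglyCartesian Q r) Φ Φ' β.hom hβ β'.hom hβ'

end

open AlgebraicGeometry TopologicalSpace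

/-! ### Gluing of endomorphisms -/

section EndSheaf

theorem exists_unique_gluing_section {X : Scheme.{0}} (M : X.Modules) {κ : Type*}
    (W : κ → X.Opens) (V : X.Opens) (hW : ∀ i, W i ≤ V) (hV : V ≤ iSup W) (s : ∀ i, Γ(M, W i))
    (hs : ∀ i j, M.presheaf.map (homOfLE (inf_le_left : W i ⊓ W j ≤ W i)).op (s i) =
      M.presheaf.map (homOfLE (inf_le_right : W i ⊓ W j ≤ W j)).op (s j)) :
    ∃! t : Γ(M, V), ∀ i, M.presheaf.map (homOfLE (hW i)).op t = s i :=
  TopCat.Sheaf.existsUnique_gluing' ⟨M.presheaf, M.isSheaf⟩ W V (fun i => homOfLE (hW i)) hV s hs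

theorem section_ext {X : Scheme.{0}} (M : X.Modules) {κ : Type*}
    (W : κ → X.Opens) (V : X.Opens) (hW : ∀ i, W i ≤ V) (hV : V ≤ iSup W) (s t : Γ(M, V))
    (h : ∀ i, M.presheaf.map (homOfLE (hW i)).op s = M.presheaf.map (homOfLE (hW i)).op t) :
    s = t :=
  TopCat.Sheaf.eq_of_locally_eq' ⟨M.presheaf, M.isSheaf⟩ W V (fun i => homOfLE (hW i)) hV s t h

theorem section_map_map {X : Scheme.{0}} (M : X.Modules) {U V W : X.Opens} (h : V ≤ U) (h' : W ≤ V)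
    (x : Γ(M, U)) : M.presheaf.map (homOfLE h').op (M.presheaf.map (homOfLE h).op x) =
      M.presheaf.map (homOfLE (h'.trans h)).op x :=
  (congrArg (fun f => f.hom x) (M.presheaf.map_comp (homOfLE h).op (homOfLE h').op)).symm

variable {X : Over SpecC} {E : X.left.Modules}

theorem EndSections.map_app {U : X.left.Opens} (f : EndSections X E U) {V W : X.left.Opens}
    (hV : V ≤ U) (h : W ≤ V) (x : Γ(E, V)) :
    E.presheaf.map (homOfLE h).op (f.app V hV x) =
      f.app W (h.trans hV) (E.presheaf.map (homOfLE h).op x) :=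
  f.2 ⟨V, hV⟩ ⟨W, h.trans hV⟩ (homOfLE h) x

theorem EndSections.ext_of_cover {κ : Type*} {U : κ → X.left.Opens} {V : X.left.Opens}
    (hU : ∀ i, U i ≤ V) (hV : V ≤ iSup U) {f g : EndSections X E V}
    (h : ∀ i, EndSections.res X E (hU i) f = EndSections.res X E (hU i) g) : f = g := by
  refine EndSections.ext fun W hW x => ?_
  refine section_ext E (fun i => W ⊓ U i) W (fun i => inf_le_left) ?_ _ _ fun i => ?_
  · rw [← inf_iSup_eq]
    exact le_inf le_rfl (hW.trans hV)
  · rw [EndSections.map_app, EndSections.map_app]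
    exact congrArg (fun k : EndSections X E (U i) => k.app (W ⊓ U i) inf_le_right
      (E.presheaf.map (homOfLE inf_le_left).op x)) (h i)

/-- Compatible endomorphisms over the members of an open cover glue. -/
theorem EndSections.exists_glue {κ : Type*} {U : κ → X.left.Opens} {V : X.left.Opens}
    (hU : ∀ i, U i ≤ V) (hV : V ≤ iSup U) (f : ∀ i, EndSections X E (U i))
    (hf : ∀ i j, EndSections.res X E (inf_le_left : U i ⊓ U j ≤ U i) (f i) =
      EndSections.res X E (inf_le_right : U i ⊓ U j ≤ U j) (f j)) :
    ∃ g : EndSections X E V, ∀ i, EndSections.res X E (hU i) g = f i := by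
  have hf' : ∀ i j (W : X.left.Opens) (hi : W ≤ U i) (hj : W ≤ U j) x,
      (f i).app W hi x = (f j).app W hj x := fun i j W hi hj x =>
    congrArg (fun k : EndSections X E (U i ⊓ U j) => k.app W (le_inf hi hj) x) (hf i j)
  have hc : ∀ W : Set.Iic V, W.1 ≤ ⨆ i, W.1 ⊓ U i := fun W => by
    rw [← inf_iSup_eq]
    exact le_inf le_rfl (W.2.trans hV)
  have key (W : Set.Iic V) (x : Γ(E, W.1)) : ∃ t : Γ(E, W.1), ∀ i,
      E.presheaf.map (homOfLE (inf_le_left : W.1 ⊓ U i ≤ W.1)).op t =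
        (f i).app (W.1 ⊓ U i) inf_le_right (E.presheaf.map (homOfLE inf_le_left).op x) := by
    refine (exists_unique_gluing_section E (fun i => W.1 ⊓ U i) W.1 (fun i => inf_le_left) (hc W)
      _ fun i j => ?_).exists
    rw [EndSections.map_app, EndSections.map_app, section_map_map, section_map_map]
    exact hf' i j _ _ _ _
  choose t ht using key
  have hext : ∀ (W : Set.Iic V) (s s' : Γ(E, W.1)),
      (∀ i, E.presheaf.map (homOfLE (inf_le_left : W.1 ⊓ U i ≤ W.1)).op s =
        E.presheaf.map (homOfLE (inf_le_left : W.1 ⊓ U i ≤ W.1)).op s') → s = s' :=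
    fun W s s' h => section_ext E (fun i => W.1 ⊓ U i) W.1 (fun i => inf_le_left) (hc W) s s' h
  have hadd : ∀ W x y, t W (x + y) = t W x + t W y := fun W x y => hext W _ _ fun i => by
    rw [ht, map_add, map_add, map_add, ht, ht]
  have hsmul : ∀ (W : Set.Iic V) (a : Γ(X.left, W.1)) x, t W (a • x) = a • t W x :=
    fun W a x => hext W _ _ fun i => by
      rw [ht, Scheme.Modules.map_smul, Scheme.Modules.map_smul, LinearMap.map_smul, ht]
  have hnat : ∀ (W W' : Set.Iic V) (h : W'.1 ≤ W.1) x,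
      E.presheaf.map (homOfLE h).op (t W x) = t W' (E.presheaf.map (homOfLE h).op x) :=
    fun W W' h x => hext W' _ _ fun i => by
      have h1 := congrArg (E.presheaf.map (homOfLE (inf_le_inf_right (U i) h)).op) (ht W x i)
      rw [section_map_map, EndSections.map_app, section_map_map] at h1
      rw [ht, section_map_map, section_map_map]
      exact h1
  let g : EndSections X E V := ⟨fun W =>
    { toFun := t W, map_add' := hadd W, map_smul' := hsmul W }, fun W W' i x => hnat W W' i.le x⟩
  refine ⟨g, fun i => EndSections.ext fun W hW x => ?_⟩
  change t ⟨W, hW.trans (hU i)⟩ x = (f i).app W hW x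
  refine hext ⟨W, hW.trans (hU i)⟩ _ _ fun j => ?_
  rw [ht, EndSections.map_app]
  exact hf' _ _ _ _ _ _

end EndSheaf

/-! ### Homomorphisms from an inverse system form a sheaf -/

section HomSheaf

variable {A B : Type} [Ring A] [Ring B] {ι : Type} [SemilatticeInf ι]

/-- The reduced idempotents are determined by the idempotents of the charts, by induction over the
index set. -/
theorem IsReducedFamily.unique [Finite ι] {e r r' : ι → A} (h : IsReducedFamily e r)
    (h' : IsReducedFamily e r') : r = r' := by
  funext σ
  induction σ using WellFoundedLT.induction with
  | ind σ ih =>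
    have h1 : ∑ᶠ τ ∈ Set.Iic σ, r τ = ∑ᶠ τ ∈ Set.Iic σ, r' τ := by
      rw [← h.sum_eq, ← h'.sum_eq]
    rw [← Set.Iio_insert, finsum_mem_insert _ (by simp) (Set.toFinite _),
      finsum_mem_insert _ (by simp) (Set.toFinite _),
      finsum_mem_congr (f := r) (g := r') (s := Set.Iio σ) rfl fun τ hτ => ih τ hτ] at h1
    exact add_right_cancel h1

theorem IsReducedFamily.map [Finite ι] {e r : ι → A} (h : IsReducedFamily e r) (g : A →+* B) :
    IsReducedFamily (fun σ => g (e σ)) fun σ => g (r σ) where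
  idem σ := by rw [← map_mul, h.idem]
  orthogonal σ σ' hσ := by rw [← map_mul, h.orthogonal σ σ' hσ, map_zero]
  sum_eq σ := by
    rw [h.sum_eq]
    exact AddMonoidHom.map_finsum_mem (f := r) g.toAddMonoidHom (Set.toFinite (Set.Iic σ))

variable [Finite ι] (Q : ιᵒᵖ ⥤ AlgCat.{0} ℂ) (X : Over SpecC) (E : X.left.Modules)

/-- The presheaf of homomorphisms is a sheaf: the actions glue, and so do the reduced idempotents,
which are determined by the actions. -/
theorem isSheaf_homPresheaf :
    Presheaf.IsSheaf (Opens.grothendieckTopology X.left) (homPresheaf Q X E) := by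
  refine TopCat.Presheaf.isSheaf_of_isSheafUniqueGluing_types (X := X.left) (homPresheaf Q X E) ?_
  intro κ U f hf
  have hU : ∀ i, U i ≤ iSup U := le_iSup U
  let res := fun i => EndSections.res X E (hU i)
  have hext : ∀ {a b : EndSections X E (iSup U)}, (∀ i, res i a = res i b) → a = b :=
    fun h => EndSections.ext_of_cover hU le_rfl h
  let f' : ∀ i, SystemHom Q (EndSections X E (U i)) := f
  have hf' : ∀ i j, (f' i).postcomp (EndSections.res X E (inf_le_left : U i ⊓ U j ≤ U i)) =
      (f' j).postcomp (EndSections.res X E (inf_le_right : U i ⊓ U j ≤ U j)) := hf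
  have hcompat : ∀ σ a i j,
      EndSections.res X E (inf_le_left : U i ⊓ U j ≤ U i) ((f' i).hom σ a) =
        EndSections.res X E (inf_le_right : U i ⊓ U j ≤ U j) ((f' j).hom σ a) := fun σ a i j =>
    congrArg (fun k : SystemHom Q (EndSections X E (U i ⊓ U j)) => k.hom σ a) (hf' i j)
  choose g hg using fun σ a =>
    EndSections.exists_glue hU le_rfl (fun i => (f' i).hom σ a) (hcompat σ a)
  replace hg : ∀ σ a i, res i (g σ a) = (f' i).hom σ a := hg
  choose r hr hr1 using fun i => (f' i).complete.complete
  have hrcompat : ∀ σ i j,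
      EndSections.res X E (inf_le_left : U i ⊓ U j ≤ U i) (r i σ) =
        EndSections.res X E (inf_le_right : U i ⊓ U j ≤ U j) (r j σ) := fun σ i j => by
    have h1 := (hr i).map
      (EndSections.res X E (inf_le_left : U i ⊓ U j ≤ U i)).toRingHom
    have h2 := (hr j).map
      (EndSections.res X E (inf_le_right : U i ⊓ U j ≤ U j)).toRingHom
    have h3 : (fun σ => (EndSections.res X E (inf_le_left : U i ⊓ U j ≤ U i)).toRingHom
        ((f' i).hom σ 1)) = fun σ => (EndSections.res X E
          (inf_le_right : U i ⊓ U j ≤ U j)).toRingHom ((f' j).hom σ 1) :=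
      funext fun σ => hcompat σ 1 i j
    rw [h3] at h1
    exact congrFun (h1.unique h2) σ
  choose s hs using fun σ => EndSections.exists_glue hU le_rfl (fun i => r i σ) (hrcompat σ)
  replace hs : ∀ σ i, res i (s σ) = r i σ := hs
  let G : SystemHom Q (EndSections X E (iSup U)) :=
    { hom := fun σ =>
        { toFun := g σ
          map_smul' := fun c a => hext fun i => by
            rw [hg, map_smul, MonoidHom.id_apply, map_smul, hg]
          map_zero' := hext fun i => by rw [hg, map_zero, map_zero]
          map_add' := fun a b => hext fun i => by rw [hg, map_add, map_add, hg, hg]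
          map_mul' := fun a b => hext fun i => by rw [hg, map_mul, map_mul, hg, hg] }
      glue := fun τ σ h =>
        { subordinate :=
            ⟨hext fun i => by
              change res i (g τ 1 * g σ 1) = res i (g τ 1)
              rw [map_mul, hg, hg]
              exact ((f' i).glue τ σ h).subordinate.1,
            hext fun i => by
              change res i (g σ 1 * g τ 1) = res i (g τ 1)
              rw [map_mul, hg, hg]
              exact ((f' i).glue τ σ h).subordinate.2⟩
          commute := fun a => hext fun i => by
            change res i (g σ a * g τ 1) = res i (g τ 1 * g σ a)
            rw [map_mul, map_mul, hg, hg]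
            exact ((f' i).glue τ σ h).commute a
          left := fun a => hext fun i => by
            change res i (g τ 1 * g σ a) = res i (g τ _)
            rw [map_mul, hg, hg, hg]
            exact ((f' i).glue τ σ h).left a
          right := fun a => hext fun i => by
            change res i (g σ a * g τ 1) = res i (g τ _)
            rw [map_mul, hg, hg, hg]
            exact ((f' i).glue τ σ h).right a }
      complete :=
        { mul_eq := fun σ σ' => hext fun i => by
            change res i (g σ 1 * g σ' 1) = res i (g (σ ⊓ σ') 1)
            rw [map_mul, hg, hg, hg]
            exact (f' i).complete.mul_eq σ σ'
          complete := ⟨s,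
            { idem := fun σ => hext fun i => by rw [map_mul, hs, (hr i).idem]
              orthogonal := fun σ σ' h => hext fun i => by
                rw [map_mul, hs, hs, (hr i).orthogonal σ σ' h, map_zero]
              sum_eq := fun σ => hext fun i => by
                change res i (g σ 1) = _
                have h1 := AddMonoidHom.map_finsum_mem (f := s) (res i).toRingHom.toAddMonoidHom
                  (Set.toFinite (Set.Iic σ))
                refine Eq.trans ?_ h1.symm
                rw [hg]
                exact ((hr i).sum_eq σ).trans (finsum_mem_congr rfl fun τ _ => (hs τ i).symm) },
            hext fun i => by
              have h1 := AddMonoidHom.map_finsum (f := s) (res i).toRingHom.toAddMonoidHom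
                (Set.toFinite _)
              refine h1.trans ?_
              rw [map_one, ← hr1 i]
              exact finsum_congr fun τ => hs τ i⟩ } }
  refine ⟨G, fun i => SystemHom.ext fun σ a => hg σ a i, fun G' hG' => ?_⟩
  let G'' : SystemHom Q (EndSections X E (iSup U)) := G'
  have h1 : ∀ i, G''.postcomp (res i) = f' i := hG'
  refine SystemHom.ext fun σ a => hext fun i => ?_
  change res i (G''.hom σ a) = res i (g σ a)
  rw [hg, ← h1 i]
  rfl

variable {Q X E}

/-- A morphism from the Azumaya scheme is given by one global homomorphism. -/
theorem AzumayaMorphism.exists_global (φ : AzumayaMorphism Q X E) :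
    ∃ f : SystemHom Q (EndSections X E ⊤), ∀ (U : X.left.Opens)
      (g : SystemHom Q (EndSections X E U)), φ.IsRepresentedBy U g →
        g = f.postcomp (EndSections.res X E le_top) := by
  let J := Opens.grothendieckTopology X.left
  have hiso : IsIso (toSheafify J (homPresheaf Q X E)) :=
    isIso_toSheafify J (isSheaf_homPresheaf Q X E)
  have hbij : ∀ U : X.left.Opensᵒᵖ,
      Function.Bijective ((toSheafify J (homPresheaf Q X E)).app U) := fun U =>
    (isIso_iff_bijective _).1 inferInstance
  obtain ⟨f, hf⟩ := (hbij (op ⊤)).2 φ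
  refine ⟨f, fun U g hg => (hbij (op U)).1 ?_⟩
  have h1 : (toSheafify J (homPresheaf Q X E)).app (op U) g =
    (sheafify J (homPresheaf Q X E)).map (homOfLE le_top : U ⟶ ⊤).op φ := hg
  rw [h1, ← hf]
  exact (NatTrans.naturality_apply (toSheafify J (homPresheaf Q X E))
    (homOfLE le_top : U ⟶ ⊤).op f).symm

end HomSheaf

open Limits

/-! ### The limit of a system of images of idempotents -/

section Partition

/-- The idempotent `e σ`, a sum of orthogonal idempotents `r ρ`, acts as the identity on the summands
which it contains, and as zero on the others (`IsReducedFamily.mul_of_not_le`). -/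
theorem IsReducedFamily.mul_of_le {A : Type} [Ring A] {ι : Type} [SemilatticeInf ι] [Finite ι]
    {e r : ι → A} (h : IsReducedFamily e r) {τ σ : ι} (hτ : τ ≤ σ) :
    e σ * r τ = r τ ∧ r τ * e σ = r τ := by
  classical
  have := Fintype.ofFinite ι
  have hs : Set.Iic σ = (↑(Finset.univ.filter (· ≤ σ)) : Set ι) := by ext; simp
  rw [h.sum_eq, hs, finsum_mem_coe_finset, Finset.sum_mul, Finset.mul_sum]
  constructor <;> rw [Finset.sum_eq_single_of_mem τ (by simpa using hτ), h.idem]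
  · exact fun ρ _ hρ => h.orthogonal ρ τ hρ
  · exact fun ρ _ hρ => h.orthogonal τ ρ hρ.symm

theorem IsReducedFamily.mul_of_not_le {A : Type} [Ring A] {ι : Type} [SemilatticeInf ι] [Finite ι]
    {e r : ι → A} (h : IsReducedFamily e r) {τ σ : ι} (hτ : ¬ τ ≤ σ) : e σ * r τ = 0 := by
  classical
  have := Fintype.ofFinite ι
  have hs : Set.Iic σ = (↑(Finset.univ.filter (· ≤ σ)) : Set ι) := by ext; simp
  rw [h.sum_eq, hs, finsum_mem_coe_finset, Finset.sum_mul]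
  refine Finset.sum_eq_zero fun ρ hρ => h.orthogonal ρ τ ?_
  rintro rfl
  exact hτ (by simpa using hρ)

variable {C D : Type*} [Category* C] [Preadditive C] [Category* D] [Preadditive D]
  {ι : Type} [PartialOrder ι] [Fintype ι]

/-- An endomorphism `r τ` of `E` for each index `τ`, on the image of which `e σ` acts as the
identity or zero according to whether `τ ≤ σ`, and which add up to the identity. -/
structure IsPartition {E : C} (e r : ι → (E ⟶ E)) : Prop where
  comp_self : ∀ τ, e τ ≫ r τ = r τ
  comp_of_le : ∀ τ σ, τ ≤ σ → r τ ≫ e σ = r τ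
  comp_of_not_le : ∀ τ σ, ¬ τ ≤ σ → r τ ≫ e σ = 0
  sum_eq : ∑ τ, r τ = 𝟙 E

theorem IsPartition.map {E : C} {e r : ι → (E ⟶ E)} (h : IsPartition e r) (G : C ⥤ D)
    [G.Additive] : IsPartition (fun σ => G.map (e σ)) fun σ => G.map (r σ) where
  comp_self τ := by rw [← G.map_comp, h.comp_self]
  comp_of_le τ σ hτ := by rw [← G.map_comp, h.comp_of_le τ σ hτ]
  comp_of_not_le τ σ hτ := by rw [← G.map_comp, h.comp_of_not_le τ σ hτ, G.map_zero]
  sum_eq := by rw [← G.map_sum, h.sum_eq, G.map_id]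

/-- A system of direct summands of `E`, with the transition maps induced from `E`, has limit `E` if
the projections `e σ` onto the summands admit a partition: a compatible family `(x σ)` comes from
`∑ τ, r τ (x τ)`. -/
theorem IsPartition.nonempty_isLimit {E : C} {S : ιᵒᵖ ⥤ C} (i : ∀ σ, S.obj σ ⟶ E)
    (p : ∀ σ, E ⟶ S.obj σ) (hip : ∀ σ, i σ ≫ p σ = 𝟙 _)
    (hS : ∀ {σ τ : ιᵒᵖ} (h : σ ⟶ τ), S.map h = i σ ≫ p τ)
    (hp : ∀ {σ τ : ιᵒᵖ} (h : σ ⟶ τ), p σ ≫ S.map h = p τ) {r : ι → (E ⟶ E)}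
    (h : IsPartition (fun σ => p (op σ) ≫ i (op σ)) r) :
    Nonempty (IsLimit (Cone.mk E { app := p, naturality := fun _ _ f => by simp [hp] } :
      Cone S)) := by
  classical
  refine ⟨
    { lift := fun s => ∑ τ, s.π.app (op τ) ≫ i (op τ) ≫ r τ
      fac := fun s σ => ?_
      uniq := fun s m hm => ?_ }⟩
  · change (∑ τ, s.π.app (op τ) ≫ i (op τ) ≫ r τ) ≫ p σ = s.π.app σ
    -- Terms with `τ ≤ σ` may be computed from the component at `σ`; the others vanish on both sides.
    have h1 : ∀ τ, (s.π.app (op τ) ≫ i (op τ) ≫ r τ) ≫ p σ ≫ i σ =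
        (s.π.app σ ≫ i σ) ≫ r τ ≫ p σ ≫ i σ := by
      intro τ
      by_cases hτ : τ ≤ σ.unop
      · have h2 := s.w (homOfLE hτ).op
        change s.π.app σ ≫ S.map (homOfLE hτ).op = s.π.app (op τ) at h2
        have h3 := h.comp_self τ
        rw [← h2, hS]
        simp only [Category.assoc] at h3 ⊢
        rw [reassoc_of% h3]
      · have h2 := h.comp_of_not_le τ σ.unop hτ
        change r τ ≫ p σ ≫ i σ = 0 at h2
        simp [h2]
    have h4 : (∑ τ, s.π.app (op τ) ≫ i (op τ) ≫ r τ) ≫ p σ ≫ i σ = s.π.app σ ≫ i σ := by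
      rw [Preadditive.sum_comp, Finset.sum_congr rfl fun τ _ => h1 τ, ← Preadditive.comp_sum,
        ← Preadditive.sum_comp, h.sum_eq, Category.id_comp, Category.assoc,
        reassoc_of% (hip σ)]
    have h5 := congrArg (· ≫ p σ) h4
    simpa only [Category.assoc, hip, Category.comp_id] using h5
  · have hm' : ∀ σ, m ≫ p σ = s.π.app σ := hm
    calc m = m ≫ ∑ τ, r τ := by rw [h.sum_eq, Category.comp_id]
      _ = ∑ τ, m ≫ r τ := by rw [Preadditive.comp_sum]
      _ = ∑ τ, s.π.app (op τ) ≫ i (op τ) ≫ r τ := by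
        refine Finset.sum_congr rfl fun τ _ => ?_
        have h3 := h.comp_self τ
        rw [← hm' (op τ), Category.assoc]
        simp only [Category.assoc] at h3
        rw [h3]

end Partition

/-! ### The graph of a homomorphism -/

section Graph

variable {X : Over SpecC} {E : X.left.Modules}

/-- A global section of the sheaf of endomorphisms is an endomorphism. -/
noncomputable def EndSections.toEnd : EndSections X E ⊤ →+* End E where
  toFun f := ⟨{ app := fun U => ModuleCat.ofHom (X := E.val.obj U) (Y := E.val.obj U)
                  (f.app U.unop le_top)
                naturality := fun {U V} i => by
                  ext x
                  exact (f.2 ⟨U.unop, Set.mem_Iic.2 le_top⟩ ⟨V.unop, Set.mem_Iic.2 le_top⟩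
                    i.unop x).symm }⟩
  map_one' := rfl
  map_mul' _ _ := rfl
  map_zero' := rfl
  map_add' _ _ := rfl

theorem EndSections.toEnd_algebraMap (c : ℂ) :
    EndSections.toEnd (algebraMap ℂ (EndSections X E ⊤) c) = scalarEnd X E c := rfl

variable {ι : Type} [SemilatticeInf ι] {Q : ιᵒᵖ ⥤ AlgCat.{0} ℂ}

/-- The endomorphism of `E` by which an element of `Q σ` acts under a global homomorphism. -/
noncomputable def SystemHom.actEnd (f : SystemHom Q (EndSections X E ⊤)) (σ : ιᵒᵖ)
    (a : Q.obj σ) : E ⟶ E :=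
  EndSections.toEnd (f.hom σ.unop a)

variable (f : SystemHom Q (EndSections X E ⊤))

theorem SystemHom.actEnd_comp (σ : ιᵒᵖ) (a b : Q.obj σ) :
    f.actEnd σ a ≫ f.actEnd σ b = f.actEnd σ (b * a) := by
  unfold SystemHom.actEnd
  rw [map_mul, map_mul]
  rfl

theorem SystemHom.actEnd_add (σ : ιᵒᵖ) (a b : Q.obj σ) :
    f.actEnd σ (a + b) = f.actEnd σ a + f.actEnd σ b := by
  unfold SystemHom.actEnd
  rw [map_add, map_add]

theorem SystemHom.actEnd_zero (σ : ιᵒᵖ) : f.actEnd σ 0 = 0 := by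
  unfold SystemHom.actEnd
  rw [map_zero, map_zero]

theorem SystemHom.actEnd_algebraMap (σ : ιᵒᵖ) (c : ℂ) :
    f.actEnd σ (algebraMap ℂ _ c) = f.actEnd σ 1 ≫ scalarEnd X E c := by
  unfold SystemHom.actEnd
  rw [Algebra.algebraMap_eq_smul_one, map_smul, Algebra.smul_def, map_mul,
    EndSections.toEnd_algebraMap]
  rfl

/-- Restriction of functions to a smaller chart corresponds to composition with the idempotent of
that chart, on either side. -/
theorem SystemHom.actEnd_map {σ τ : ιᵒᵖ} (h : σ ⟶ τ) (a : Q.obj σ) :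
    f.actEnd σ a ≫ f.actEnd τ 1 = f.actEnd τ ((Q.map h).hom a) ∧
      f.actEnd τ 1 ≫ f.actEnd σ a = f.actEnd τ ((Q.map h).hom a) := by
  rcases h.unop.le.eq_or_lt with heq | hlt
  · obtain rfl : τ = σ := unop_injective heq
    have h1 : h = 𝟙 τ := Subsingleton.elim _ _
    have h2 : (Q.map h).hom a = a := by rw [h1, Q.map_id]; rfl
    rw [h2, actEnd_comp, actEnd_comp, one_mul, mul_one]
    exact ⟨rfl, rfl⟩
  · have H := f.glue τ.unop σ.unop hlt
    exact ⟨congrArg EndSections.toEnd (H.left a), congrArg EndSections.toEnd (H.right a)⟩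

theorem SystemHom.actEnd_one_comp {σ τ : ιᵒᵖ} (h : σ ⟶ τ) :
    f.actEnd σ 1 ≫ f.actEnd τ 1 = f.actEnd τ 1 ∧ f.actEnd τ 1 ≫ f.actEnd σ 1 = f.actEnd τ 1 := by
  have := f.actEnd_map h 1
  rwa [map_one] at this

/-- The idempotents of a homomorphism admit a partition, by the reduced idempotents. -/
theorem SystemHom.exists_isPartition [Fintype ι] :
    ∃ r : ι → (E ⟶ E), IsPartition (fun σ => f.actEnd (op σ) 1) r := by
  obtain ⟨r, hr, hr1⟩ := f.complete.complete
  refine ⟨fun σ => EndSections.toEnd (r σ), fun τ => ?_, fun τ σ h => ?_, fun τ σ h => ?_, ?_⟩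
  · exact congrArg EndSections.toEnd (hr.mul_of_le le_rfl).2
  · exact congrArg EndSections.toEnd (hr.mul_of_le h).1
  · exact congrArg EndSections.toEnd (hr.mul_of_not_le h)
  · rw [finsum_eq_sum_of_fintype] at hr1
    exact ((map_sum EndSections.toEnd r Finset.univ).symm.trans
      (congrArg EndSections.toEnd hr1)).trans (map_one EndSections.toEnd)

/-- The module with components `e_σ E`, for splittings `e_σ = p σ ≫ i σ` of the idempotents of a
homomorphism. -/
noncomputable def SystemHom.graph (Y : ιᵒᵖ → X.left.Modules) (i : ∀ σ, Y σ ⟶ E) (p : ∀ σ, E ⟶ Y σ)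
    (hip : ∀ σ, i σ ≫ p σ = 𝟙 _) (hpi : ∀ σ, p σ ≫ i σ = f.actEnd σ 1) : ProductModule Q X where
  system :=
    { obj := Y
      map := fun {σ τ} _ => i σ ≫ p τ
      map_id := hip
      map_comp := fun {σ τ ρ} g h => by
        have h1 : f.actEnd τ 1 ≫ p ρ = p ρ := by
          have h2 := congrArg (· ≫ p ρ) (f.actEnd_one_comp h).1
          simpa only [← hpi, Category.assoc, hip, Category.comp_id] using h2
        rw [Category.assoc, reassoc_of% (hpi τ), h1] }
  act σ :=
    { toFun := fun a => i σ ≫ f.actEnd σ a ≫ p σ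
      map_one' := by
        change i σ ≫ f.actEnd σ 1 ≫ p σ = 𝟙 _
        rw [← hpi, Category.assoc, reassoc_of% (hip σ), hip]
      map_mul' := fun a b => by
        change i σ ≫ f.actEnd σ (a * b) ≫ p σ =
          (i σ ≫ f.actEnd σ b ≫ p σ) ≫ i σ ≫ f.actEnd σ a ≫ p σ
        have h1 : p σ ≫ i σ ≫ f.actEnd σ a = f.actEnd σ a := by
          rw [reassoc_of% (hpi σ), f.actEnd_comp, mul_one]
        rw [← f.actEnd_comp]
        simp only [Category.assoc]
        rw [reassoc_of% h1]
      map_zero' := by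
        change i σ ≫ f.actEnd σ 0 ≫ p σ = 0
        rw [f.actEnd_zero, zero_comp, comp_zero]
      map_add' := fun a b => by
        change i σ ≫ f.actEnd σ (a + b) ≫ p σ =
          i σ ≫ f.actEnd σ a ≫ p σ + i σ ≫ f.actEnd σ b ≫ p σ
        rw [f.actEnd_add, Preadditive.add_comp, Preadditive.comp_add] }
  act_algebraMap σ c := by
    change i σ ≫ f.actEnd σ (algebraMap ℂ _ c) ≫ p σ = _
    rw [f.actEnd_algebraMap, Category.assoc, scalarEnd_naturality, ← hpi, Category.assoc,
      reassoc_of% (hip σ), reassoc_of% (hip σ)]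
  act_map {σ τ} h a := by
    change (i σ ≫ f.actEnd σ a ≫ p σ) ≫ i σ ≫ p τ =
      (i σ ≫ p τ) ≫ i τ ≫ f.actEnd τ ((Q.map h).hom a) ≫ p τ
    have h1 : f.actEnd σ a ≫ p σ ≫ i σ = f.actEnd σ a := by
      rw [hpi, f.actEnd_comp, one_mul]
    have h2 : p τ ≫ i τ ≫ f.actEnd τ ((Q.map h).hom a) = f.actEnd τ ((Q.map h).hom a) := by
      rw [reassoc_of% (hpi τ), f.actEnd_comp, mul_one]
    have h3 : f.actEnd τ ((Q.map h).hom a) ≫ p τ = f.actEnd σ a ≫ p τ := by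
      rw [← (f.actEnd_map h a).1, Category.assoc, ← hpi, Category.assoc, hip, Category.comp_id]
    simp only [Category.assoc]
    rw [reassoc_of% h1, reassoc_of% h2, h3]

end Graph

/-! ### Idempotent matrices -/

/-- An idempotent matrix can be diagonalized near a point. The columns of `B` are chosen among those
of `P` and of `1 - P`, which together span the fiber at the point. -/
theorem exists_diagonalization_of_idempotent {A K : Type*} [CommRing A] [Field K] (φ : A →+* K)
    {r : ℕ} (P : Matrix (Fin r) (Fin r) A) (hP : P * P = P) :
    ∃ (B : Matrix (Fin r) (Fin r) A) (J : Set (Fin r)),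
      P * B = B * Matrix.diagonal (J.indicator 1) ∧ φ B.det ≠ 0 := by
  classical
  let c : Fin r ⊕ Fin r → Fin r → A := Sum.elim P.col (1 - P).col
  let v : Fin r ⊕ Fin r → Fin r → K := fun s i => φ (c s i)
  obtain ⟨κ, a, ha, hspan, hli⟩ := exists_linearIndependent' K v
  have htop : Submodule.span K (Set.range v) = ⊤ := by
    rw [eq_top_iff, ← (Pi.basisFun K (Fin r)).span_eq, Submodule.span_le]
    rintro _ ⟨j, rfl⟩
    have h1 : Pi.basisFun K (Fin r) j = v (Sum.inl j) + v (Sum.inr j) := by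
      funext i
      simp only [v, c, Pi.basisFun_apply, Pi.add_apply, Sum.elim_inl, Sum.elim_inr,
        Matrix.col_apply, Matrix.sub_apply, map_sub, add_sub_cancel, Matrix.one_apply,
        Pi.single_apply]
      split <;> simp
    rw [SetLike.mem_coe, h1]
    exact add_mem (Submodule.subset_span ⟨_, rfl⟩) (Submodule.subset_span ⟨_, rfl⟩)
  have : Finite κ := Finite.of_injective a ha
  have := Fintype.ofFinite κ
  have hcard : Fintype.card κ = r := by
    have b := Module.Basis.mk hli (by rw [hspan, htop])
    simpa using (Module.finrank_eq_card_basis b).symm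
  let t : Fin r ≃ κ := (Fintype.equivFinOfCardEq hcard).symm
  let B : Matrix (Fin r) (Fin r) A := Matrix.of fun i j => c (a (t j)) i
  refine ⟨B, {j | (a (t j)).isLeft}, ?_, ?_⟩
  · have hcol : ∀ s i, ∑ k, P i k * c s k = if s.isLeft then c s i else 0 := by
      intro s i
      rcases s with j | j
      · have h1 := congrFun (congrFun hP i) j
        simpa [Matrix.mul_apply, c] using h1
      · have h1 : P * (1 - P) = 0 := by rw [mul_sub, mul_one, hP, sub_self]
        have h2 := congrFun (congrFun h1 i) j
        simpa [Matrix.mul_apply, c] using h2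
    ext i j
    rw [Matrix.mul_diagonal, Matrix.mul_apply]
    refine (hcol (a (t j)) i).trans ?_
    by_cases h : (a (t j)).isLeft = true <;> simp [h, B, Set.indicator]
  · have h1 : LinearIndependent K (B.map φ).col := (hli.comp t t.injective : _)
    rw [RingHom.map_det]
    exact ((Matrix.isUnit_iff_isUnit_det _).1 (Matrix.linearIndependent_cols_iff_isUnit.1 h1)).ne_zero

/-! ### Endomorphisms of free modules -/

section Free

variable {S : Scheme.{0}}

/-- Multiplication by a global function. -/
noncomputable def mulEnd (M : S.Modules) (a : Γ(S, ⊤)) : M ⟶ M :=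
  ⟨{ app := fun U => ModuleCat.ofHom
      (X := M.val.obj U) (Y := M.val.obj U)
      { toFun := fun x => (S.presheaf.map (homOfLE (le_top : U.unop ≤ ⊤)).op a •
          (show Γ(M, U.unop) from x) : Γ(M, U.unop))
        map_add' := fun x y => smul_add (M := Γ(S, U.unop)) (A := Γ(M, U.unop)) _ _ _
        map_smul' := fun a x => smul_comm (M := Γ(S, U.unop)) (N := Γ(S, U.unop))
          (α := Γ(M, U.unop)) _ _ _ }
     naturality := by
      intro U V i
      ext x
      have h0 : S.presheaf.map i.unop.op (S.presheaf.map (homOfLE (le_top : U.unop ≤ ⊤)).op a) =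
          S.presheaf.map (homOfLE (le_top : V.unop ≤ ⊤)).op a :=
        (congrArg (fun f => f.hom a) (S.presheaf.map_comp (homOfLE (le_top : U.unop ≤ ⊤)).op
          i.unop.op)).symm
      have h : M.presheaf.map i.unop.op (S.presheaf.map (homOfLE (le_top : U.unop ≤ ⊤)).op a •
          (show Γ(M, U.unop) from x)) = S.presheaf.map (homOfLE (le_top : V.unop ≤ ⊤)).op a •
            M.presheaf.map i.unop.op (show Γ(M, U.unop) from x) := by
        rw [Scheme.Modules.map_smul, h0]
      exact h.symm }⟩

theorem mulEnd_app (M : S.Modules) (a : Γ(S, ⊤)) (U : S.Opens) (x : Γ(M, U)) :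
    (mulEnd M a).app U x = S.presheaf.map (homOfLE (le_top : U ≤ ⊤)).op a • x := rfl

theorem mulEnd_naturality {M N : S.Modules} (f : M ⟶ N) (a : Γ(S, ⊤)) :
    mulEnd M a ≫ f = f ≫ mulEnd N a := by
  ext U x
  exact Scheme.Modules.Hom.app_smul f _ x

theorem mulEnd_mul (M : S.Modules) (a b : Γ(S, ⊤)) : mulEnd M (a * b) = mulEnd M b ≫ mulEnd M a := by
  ext U x
  change (mulEnd M (a * b)).app U x = (mulEnd M a).app U ((mulEnd M b).app U x)
  rw [mulEnd_app, mulEnd_app, mulEnd_app, map_mul, mul_smul]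

theorem mulEnd_add (M : S.Modules) (a b : Γ(S, ⊤)) : mulEnd M (a + b) = mulEnd M a + mulEnd M b := by
  ext U x
  change (mulEnd M (a + b)).app U x = (mulEnd M a).app U x + (mulEnd M b).app U x
  rw [mulEnd_app, mulEnd_app, mulEnd_app, map_add, add_smul]

theorem mulEnd_zero (M : S.Modules) : mulEnd M 0 = 0 := by
  ext U x
  change (mulEnd M 0).app U x = 0
  rw [mulEnd_app, map_zero, zero_smul]

theorem mulEnd_one (M : S.Modules) : mulEnd M 1 = 𝟙 M := by
  ext U x
  change (mulEnd M 1).app U x = x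
  rw [mulEnd_app, map_one, one_smul]

/-- Multiplication by a function becomes invertible on an open subset where the function is. -/
theorem isIso_restrict_mulEnd (M : S.Modules) (a : Γ(S, ⊤)) (V : S.Opens)
    (ha : IsUnit (S.presheaf.map (homOfLE (le_top : V ≤ ⊤)).op a)) :
    IsIso ((Scheme.Modules.restrictFunctor V.ι).map (mulEnd M a)) := by
  rw [Scheme.Modules.Hom.isIso_iff_isIso_app]
  intro W
  have hW : V.ι ''ᵁ W ≤ V := by
    simpa using V.ι.image_le_opensRange W
  have h0 : S.presheaf.map (homOfLE hW).op (S.presheaf.map (homOfLE (le_top : V ≤ ⊤)).op a) =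
      S.presheaf.map (homOfLE (le_top : V.ι ''ᵁ W ≤ ⊤)).op a :=
    (congrArg (fun f => f.hom a) (S.presheaf.map_comp (homOfLE (le_top : V ≤ ⊤)).op
      (homOfLE hW).op)).symm
  have hu : IsUnit (S.presheaf.map (homOfLE (le_top : V.ι ''ᵁ W ≤ ⊤)).op a) := by
    rw [← h0]
    exact ha.map (S.presheaf.map (homOfLE hW).op).hom
  have h2 : IsIso ((mulEnd M a).app (V.ι ''ᵁ W)) := by
    rw [ConcreteCategory.isIso_iff_bijective]
    exact hu.smul_bijective
  exact h2

/-- The structure sheaf as a module over itself. -/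
noncomputable abbrev unitModule (S : Scheme.{0}) : S.Modules := SheafOfModules.unit S.ringCatSheaf

/-- The free module on a set. -/
noncomputable abbrev freeModule (S : Scheme.{0}) (I : Type) : S.Modules :=
  SheafOfModules.free (R := S.ringCatSheaf) I

theorem mulEnd_surjective (g : unitModule S ⟶ unitModule S) : ∃ a, g = mulEnd _ a := by
  let a : Γ(S, ⊤) := g.app ⊤ (1 : Γ(S, ⊤))
  refine ⟨a, ?_⟩
  apply ((unitModule S).unitHomEquiv).injective
  ext U
  change g.app U.unop (1 : Γ(S, U.unop)) =
    S.presheaf.map (homOfLE (le_top : U.unop ≤ ⊤)).op a * 1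
  have h1 := ConcreteCategory.congr_hom
    (g.mapPresheaf.naturality (homOfLE (le_top : U.unop ≤ ⊤)).op) (1 : Γ(S, ⊤))
  have h2 : S.presheaf.map (homOfLE (le_top : U.unop ≤ ⊤)).op 1 = 1 := map_one _
  refine Eq.trans (Eq.trans ?_ h1) (mul_one (M := Γ(S, U.unop)) _).symm
  exact congrArg (g.app U.unop) h2.symm

theorem mulEnd_injective : Function.Injective (mulEnd (unitModule S)) := by
  intro a b h
  have h1 : ∀ c : Γ(S, ⊤), (mulEnd (unitModule S) c).app ⊤ (1 : Γ(S, ⊤)) = c := fun c => by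
    change S.presheaf.map (homOfLE (le_top : (⊤ : S.Opens) ≤ ⊤)).op c * 1 = c
    have h2 : (homOfLE (le_top : (⊤ : S.Opens) ≤ ⊤)).op = 𝟙 _ := rfl
    rw [mul_one, h2, S.presheaf.map_id]
    rfl
  rw [← h1 a, h, h1 b]

/-- The inclusion of a coordinate into the free module. -/
noncomputable def coordInl {I : Type} (j : I) : unitModule S ⟶ freeModule S I :=
  SheafOfModules.ιFree j

/-- The morphism from the free module given by the images of the coordinates. -/
noncomputable def freeDesc {I : Type} {M : S.Modules} (f : I → (unitModule S ⟶ M)) :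
    freeModule S I ⟶ M :=
  Cofan.IsColimit.desc (SheafOfModules.isColimitFreeCofan I) f

theorem coordInl_desc {I : Type} {M : S.Modules} (f : I → (unitModule S ⟶ M)) (j : I) :
    coordInl j ≫ freeDesc f = f j :=
  Cofan.IsColimit.fac (SheafOfModules.isColimitFreeCofan I) f j

theorem freeModule_hom_ext {I : Type} {M : S.Modules} {f g : freeModule S I ⟶ M}
    (h : ∀ j, coordInl j ≫ f = coordInl j ≫ g) : f = g :=
  Cofan.IsColimit.hom_ext (SheafOfModules.isColimitFreeCofan I) _ _ h

variable {r : ℕ}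

/-- The projection of the free module to a coordinate. -/
noncomputable def coordProj (k : Fin r) : freeModule S (Fin r) ⟶ unitModule S :=
  freeDesc fun j => if j = k then 𝟙 _ else 0

theorem sum_coordProj_comp_coordInl :
    ∑ k : Fin r, coordProj k ≫ coordInl k = 𝟙 (freeModule S (Fin r)) := by
  refine freeModule_hom_ext fun j => ?_
  rw [Preadditive.comp_sum, Finset.sum_eq_single j]
  · rw [coordProj, reassoc_of% coordInl_desc, if_pos rfl, Category.id_comp, Category.comp_id]
  · intro k _ hk
    rw [coordProj, reassoc_of% coordInl_desc, if_neg hk.symm, zero_comp]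
  · simp

/-- The endomorphism of the free module given by a matrix, acting on column vectors. -/
noncomputable def matEnd (P : Matrix (Fin r) (Fin r) Γ(S, ⊤)) :
    freeModule S (Fin r) ⟶ freeModule S (Fin r) :=
  freeDesc fun j => ∑ k, mulEnd _ (P k j) ≫ coordInl k

theorem coordInl_matEnd (P : Matrix (Fin r) (Fin r) Γ(S, ⊤)) (j : Fin r) :
    coordInl j ≫ matEnd P = ∑ k, mulEnd _ (P k j) ≫ coordInl k :=
  coordInl_desc _ j

theorem mulEnd_sum {κ : Type*} (M : S.Modules) (s : Finset κ) (a : κ → Γ(S, ⊤)) :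
    mulEnd M (∑ k ∈ s, a k) = ∑ k ∈ s, mulEnd M (a k) :=
  map_sum (⟨⟨mulEnd M, mulEnd_zero M⟩, mulEnd_add M⟩ : Γ(S, ⊤) →+ (M ⟶ M)) a s

theorem matEnd_mul (P R : Matrix (Fin r) (Fin r) Γ(S, ⊤)) :
    matEnd (P * R) = matEnd R ≫ matEnd P := by
  refine freeModule_hom_ext fun j => ?_
  rw [← Category.assoc, coordInl_matEnd, coordInl_matEnd, Preadditive.sum_comp]
  simp only [Category.assoc, coordInl_matEnd, Preadditive.comp_sum]
  rw [Finset.sum_comm]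
  refine Finset.sum_congr rfl fun l _ => ?_
  rw [Matrix.mul_apply, mulEnd_sum, Preadditive.sum_comp]
  refine Finset.sum_congr rfl fun k _ => ?_
  rw [mulEnd_mul, Category.assoc]

theorem matEnd_surjective (e : freeModule S (Fin r) ⟶ freeModule S (Fin r)) :
    ∃ P, matEnd P = e := by
  choose P hP using fun k j : Fin r => mulEnd_surjective (coordInl j ≫ e ≫ coordProj k)
  refine ⟨Matrix.of P, freeModule_hom_ext fun j => ?_⟩
  rw [coordInl_matEnd]
  calc _ = ∑ k, (coordInl j ≫ e ≫ coordProj k) ≫ coordInl k :=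
        Finset.sum_congr rfl fun k _ => by rw [hP]; rfl
    _ = coordInl j ≫ e := by
      simp only [Category.assoc]
      rw [← Preadditive.comp_sum, ← Preadditive.comp_sum, sum_coordProj_comp_coordInl,
        Category.comp_id]

theorem matEnd_injective : Function.Injective (matEnd (S := S) (r := r)) := by
  intro P R h
  have key : ∀ (P : Matrix (Fin r) (Fin r) Γ(S, ⊤)) k j,
      coordInl j ≫ matEnd P ≫ coordProj k = mulEnd _ (P k j) := by
    intro P k j
    rw [← Category.assoc, coordInl_matEnd, Preadditive.sum_comp, Finset.sum_eq_single k]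
    · rw [Category.assoc, coordProj, coordInl_desc, if_pos rfl, Category.comp_id]
    · intro l _ hl
      rw [Category.assoc, coordProj, coordInl_desc, if_neg hl, comp_zero]
    · simp
  ext k j
  apply mulEnd_injective
  rw [← key, h, key]

theorem matEnd_diagonal_indicator (J : Set (Fin r)) (j : Fin r) [Decidable (j ∈ J)] :
    coordInl (S := S) j ≫ matEnd (Matrix.diagonal (J.indicator 1)) =
      if j ∈ J then coordInl j else 0 := by
  rw [coordInl_matEnd, Finset.sum_eq_single j]
  · rw [Matrix.diagonal_apply_eq]
    split_ifs with h
    · rw [Set.indicator_of_mem h, Pi.one_apply, mulEnd_one, Category.id_comp]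
    · rw [Set.indicator_of_notMem h, mulEnd_zero, zero_comp]
  · intro k _ hk
    rw [Matrix.diagonal_apply_ne _ hk, mulEnd_zero, zero_comp]
  · simp

theorem matEnd_smul_one (d : Γ(S, ⊤)) :
    matEnd (d • (1 : Matrix (Fin r) (Fin r) Γ(S, ⊤))) = mulEnd _ d := by
  refine freeModule_hom_ext fun j => ?_
  rw [coordInl_matEnd, Finset.sum_eq_single j]
  · rw [Matrix.smul_apply, Matrix.one_apply_eq, smul_eq_mul, mul_one, mulEnd_naturality]
  · intro k _ hk
    rw [Matrix.smul_apply, Matrix.one_apply_ne hk, smul_zero, mulEnd_zero, zero_comp]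
  · simp

/-- The image of the diagonal matrix with entries `1` on `J` and `0` elsewhere is free on `J`. -/
theorem exists_splitting_diagonal_indicator (J : Set (Fin r)) :
    ∃ (i : freeModule S J ⟶ freeModule S (Fin r)) (p : freeModule S (Fin r) ⟶ freeModule S J),
      i ≫ p = 𝟙 _ ∧ p ≫ i = matEnd (Matrix.diagonal (J.indicator 1)) := by
  classical
  refine ⟨freeDesc fun j => coordInl j.1,
    freeDesc fun j => if h : j ∈ J then coordInl ⟨j, h⟩ else 0,
    freeModule_hom_ext fun j => ?_, freeModule_hom_ext fun j => ?_⟩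
  · rw [reassoc_of% coordInl_desc, coordInl_desc, dif_pos j.2, Category.comp_id]
  · rw [reassoc_of% coordInl_desc, matEnd_diagonal_indicator]
    split_ifs with h
    · rw [coordInl_desc]
    · rw [zero_comp]

/-- A matrix becomes invertible on an open subset where its determinant is. -/
theorem isIso_restrict_matEnd (B : Matrix (Fin r) (Fin r) Γ(S, ⊤)) (V : S.Opens)
    (hB : IsUnit (S.presheaf.map (homOfLE (le_top : V ≤ ⊤)).op B.det)) :
    IsIso ((Scheme.Modules.restrictFunctor V.ι).map (matEnd B)) := by
  let G := Scheme.Modules.restrictFunctor V.ι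
  have := isIso_restrict_mulEnd (freeModule S (Fin r)) B.det V hB
  have h1 : matEnd B ≫ matEnd B.adjugate = mulEnd _ B.det := by
    rw [← matEnd_mul, Matrix.adjugate_mul, matEnd_smul_one]
  have h2 : matEnd B.adjugate ≫ matEnd B = mulEnd _ B.det := by
    rw [← matEnd_mul, Matrix.mul_adjugate, matEnd_smul_one]
  have h3 : IsIso (G.map (matEnd B) ≫ G.map (matEnd B.adjugate)) := by
    rw [← G.map_comp, h1]; exact this
  have h4 : IsIso (G.map (matEnd B.adjugate) ≫ G.map (matEnd B)) := by
    rw [← G.map_comp, h2]; exact this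
  have : Mono (G.map (matEnd B)) := mono_of_mono _ (G.map (matEnd B.adjugate))
  have : Epi (G.map (matEnd B)) := epi_of_epi (G.map (matEnd B.adjugate)) _
  exact isIso_of_mono_of_epi _

end Free

/-! ### Locally free modules -/

section LocallyFree

variable {S T : Scheme.{0}}

/-- The restriction of a free module to an open subscheme is free. -/
noncomputable def restrictFreeIso (f : T ⟶ S) [IsOpenImmersion f] (I : Type) :
    (freeModule S I).restrict f ≅ freeModule T I :=
  let G : SheafOfModules S.ringCatSheaf ⥤ SheafOfModules T.ringCatSheaf :=
    Scheme.Modules.restrictFunctor f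
  have : PreservesColimitsOfShape (Discrete I) G :=
    (inferInstance : PreservesColimitsOfShape (Discrete I) (Scheme.Modules.restrictFunctor f))
  (SheafOfModules.mapFreeIso G I (Scheme.Modules.restrictUnitIso f).symm).symm

instance final_opensMap {X Y : TopCat.{0}} (f : X ⟶ Y) : (Opens.map f).Final :=
  Functor.final_of_exists_of_isFiltered _ (fun _ => ⟨⊤, ⟨homOfLE le_top⟩⟩)
    fun {_ c} _ _ => ⟨c, 𝟙 _, Subsingleton.elim _ _⟩

/-- The pullback of a free module is free. -/
noncomputable def pullbackFreeIso (f : T ⟶ S) (I : Type) :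
    (Scheme.Modules.pullback f).obj (freeModule S I) ≅ freeModule T I :=
  have : (Opens.map f.base).Final := final_opensMap f.base
  have : (SheafOfModules.pushforward.{0} f.toRingCatSheafHom).IsRightAdjoint :=
    (inferInstance : (Scheme.Modules.pushforward f).IsRightAdjoint)
  SheafOfModules.pullbackObjFreeIso f.toRingCatSheafHom I

theorem nonempty_restrict_range_iso_free {M : S.Modules} {W : Scheme.{0}} (j : W ⟶ S)
    [IsOpenImmersion j] {I : Type} (e : M.restrict j ≅ freeModule W I) :
    Nonempty (M.restrict j.opensRange.ι ≅ freeModule j.opensRange I) := by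
  let t := j.isoOpensRange
  have ht : t.inv ≫ j = j.opensRange.ι := j.isoOpensRange_inv_comp
  exact ⟨(Scheme.Modules.restrictFunctorCongr ht.symm).app M ≪≫
    (Scheme.Modules.restrictFunctorComp t.inv j).app M ≪≫
    (Scheme.Modules.restrictFunctor t.inv).mapIso e ≪≫ restrictFreeIso t.inv I⟩

theorem IsLocallyFreeOfRank.pullback {M : S.Modules} {r : ℕ} (h : IsLocallyFreeOfRank M r)
    (f : T ⟶ S) : IsLocallyFreeOfRank ((Scheme.Modules.pullback f).obj M) r := by
  intro x
  obtain ⟨U, hx, ⟨e⟩⟩ := h (f x)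
  refine ⟨f ⁻¹ᵁ U, hx, ⟨?_⟩⟩
  have h1 : f ∣_ U ≫ U.ι = (f ⁻¹ᵁ U).ι ≫ f := morphismRestrict_ι f U
  exact (Scheme.Modules.restrictFunctorIsoPullback _).app _ ≪≫
    (Scheme.Modules.pullbackComp (f ⁻¹ᵁ U).ι f).app M ≪≫
    (Scheme.Modules.pullbackCongr h1.symm).app M ≪≫
    (Scheme.Modules.pullbackComp (f ∣_ U) U.ι).symm.app M ≪≫
    (Scheme.Modules.pullback (f ∣_ U)).mapIso
      ((Scheme.Modules.restrictFunctorIsoPullback U.ι).symm.app M ≪≫ e) ≪≫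
    pullbackFreeIso (f ∣_ U) (Fin r)

/-- A direct summand of a free module of finite rank is free near every point. -/
theorem exists_restrict_summand_iso_free {r : ℕ} {N : S.Modules} (i : N ⟶ freeModule S (Fin r))
    (p : freeModule S (Fin r) ⟶ N) (hip : i ≫ p = 𝟙 N) (x : S) :
    ∃ (V : S.Opens) (k : ℕ), x ∈ V ∧
      Nonempty (N.restrict V.ι ≅ freeModule (V : Scheme.{0}) (Fin k)) := by
  obtain ⟨P, hP⟩ := matEnd_surjective (p ≫ i)
  have hPP : P * P = P := matEnd_injective (by
    rw [matEnd_mul, hP, Category.assoc, reassoc_of% hip])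
  let φ : Γ(S, ⊤) →+* S.residueField x := (S.evaluation ⊤ x (Opens.mem_top x)).hom
  obtain ⟨B, J, hBJ, hB⟩ := exists_diagonalization_of_idempotent φ P hPP
  let V := S.basicOpen B.det
  have hxV : x ∈ V := (S.evaluation_ne_zero_iff_mem_basicOpen x (Opens.mem_top x) B.det).1 hB
  let G := Scheme.Modules.restrictFunctor V.ι
  have : IsIso (G.map (matEnd B)) :=
    isIso_restrict_matEnd B V (RingedSpace.isUnit_res_basicOpen S.toRingedSpace B.det)
  obtain ⟨iJ, pJ, hJ1, hJ2⟩ := exists_splitting_diagonal_indicator (S := S) J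
  have hcomm : matEnd B ≫ p ≫ i = (pJ ≫ iJ) ≫ matEnd B := by
    rw [hJ2, ← hP, ← matEnd_mul, ← matEnd_mul, hBJ]
  let b := asIso (G.map (matEnd B))
  -- Both `N` and the free module on `J` split the restriction of the same idempotent, up to `B`.
  have hcomm' : b.hom ≫ G.map p ≫ G.map i = G.map pJ ≫ G.map iJ ≫ b.hom := by
    have := congrArg G.map hcomm
    change G.map (matEnd B) ≫ _ = G.map pJ ≫ _ ≫ G.map (matEnd B)
    simpa only [G.map_comp, Category.assoc] using this
  have hip' : G.map i ≫ G.map p = 𝟙 _ := by rw [← G.map_comp, hip, G.map_id]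
  have hJ1' : G.map iJ ≫ G.map pJ = 𝟙 _ := by rw [← G.map_comp, hJ1, G.map_id]
  have hcomm'' : b.inv ≫ G.map pJ ≫ G.map iJ = G.map p ≫ G.map i ≫ b.inv := by
    rw [Iso.inv_comp_eq, ← Category.assoc, ← Category.assoc, Iso.eq_comp_inv]
    simpa only [Category.assoc] using hcomm'.symm
  let e : G.obj N ≅ G.obj (freeModule S J) :=
    { hom := G.map i ≫ b.inv ≫ G.map pJ
      inv := G.map iJ ≫ b.hom ≫ G.map p
      hom_inv_id := by
        simp only [Category.assoc]
        rw [reassoc_of% hcomm'', Iso.inv_hom_id_assoc, hip', reassoc_of% hip']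
      inv_hom_id := by
        simp only [Category.assoc]
        rw [reassoc_of% hcomm', Iso.hom_inv_id_assoc, hJ1', reassoc_of% hJ1'] }
  have : Finite J := inferInstance
  let t : J ≃ Fin (Nat.card J) := Finite.equivFin J
  exact ⟨V, Nat.card J, hxV, ⟨e ≪≫ restrictFreeIso V.ι J ≪≫
    (SheafOfModules.freeFunctor (R := (V : Scheme.{0}).ringCatSheaf)).mapIso t.toIso⟩⟩

/-- A direct summand of a locally free module of finite rank is locally free of finite rank. -/
theorem IsLocallyFreeOfRank.isFiniteLocallyFree_of_summand {r : ℕ} {M N : S.Modules}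
    (h : IsLocallyFreeOfRank M r) (i : N ⟶ M) (p : M ⟶ N) (hip : i ≫ p = 𝟙 N) :
    IsFiniteLocallyFree N := by
  intro x
  obtain ⟨U, hx, ⟨e₀⟩⟩ := h x
  let G := Scheme.Modules.restrictFunctor U.ι
  let e : G.obj M ≅ freeModule (U : Scheme.{0}) (Fin r) := e₀
  have hip' : (G.map i ≫ e.hom) ≫ e.inv ≫ G.map p = 𝟙 _ := by
    rw [Category.assoc, e.hom_inv_id_assoc, ← G.map_comp, hip, G.map_id]
  obtain ⟨V, k, hxV, ⟨e'⟩⟩ := exists_restrict_summand_iso_free _ _ hip' ⟨x, hx⟩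
  obtain ⟨e''⟩ := nonempty_restrict_range_iso_free (V.ι ≫ U.ι)
    ((Scheme.Modules.restrictFunctorComp V.ι U.ι).app N ≪≫ e')
  exact ⟨(V.ι ≫ U.ι).opensRange, k, ⟨⟨⟨x, hx⟩, hxV⟩, rfl⟩, ⟨e''⟩⟩

end LocallyFree

/-! ### The graph is a flat family -/

section GraphFamily

variable {X : Over SpecC} {E : X.left.Modules} {ι : Type} [SemilatticeInf ι]
  {Q : ιᵒᵖ ⥤ AlgCat.{0} ℂ} (f : SystemHom Q (EndSections X E ⊤)) (Y : ιᵒᵖ → X.left.Modules)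
  (i : ∀ σ, Y σ ⟶ E) (p : ∀ σ, E ⟶ Y σ) (hip : ∀ σ, i σ ≫ p σ = 𝟙 _)
  (hpi : ∀ σ, p σ ≫ i σ = f.actEnd σ 1)

theorem SystemHom.comp_graph_map {σ τ : ιᵒᵖ} (h : σ ⟶ τ) :
    p σ ≫ (f.graph Y i p hip hpi).system.map h = p τ := by
  change p σ ≫ i σ ≫ p τ = p τ
  have h1 := congrArg (· ≫ p τ) (f.actEnd_one_comp h).1
  simpa only [← hpi, Category.assoc, hip, Category.comp_id] using h1

variable [Finite ι]

/-- An additive functor takes the system of components of the graph to a system with limit the image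
of `E`. -/
theorem SystemHom.nonempty_limit_graph_iso {D : Type*} [Category* D] [Preadditive D]
    (G : X.left.Modules ⥤ D) [G.Additive] [HasLimit ((f.graph Y i p hip hpi).system ⋙ G)] :
    Nonempty (limit ((f.graph Y i p hip hpi).system ⋙ G) ≅ G.obj E) := by
  have := Fintype.ofFinite ι
  obtain ⟨r, hr⟩ := f.exists_isPartition
  have hr' := hr.map G
  have h1 : (fun σ : ι => G.map (f.actEnd (op σ) 1)) =
      fun σ => G.map (p (op σ)) ≫ G.map (i (op σ)) := by
    funext σ
    rw [← G.map_comp, hpi]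
  rw [h1] at hr'
  obtain ⟨hl⟩ := hr'.nonempty_isLimit (S := (f.graph Y i p hip hpi).system ⋙ G)
    (fun σ => G.map (i σ)) (fun σ => G.map (p σ))
    (fun σ => (G.map_comp _ _).symm.trans ((congrArg G.map (hip σ)).trans (G.map_id _)))
    (fun {σ τ} _ => G.map_comp (i σ) (p τ))
    (fun h => (G.map_comp _ _).symm.trans (congrArg G.map (f.comp_graph_map Y i p hip hpi h)))
  exact ⟨(limit.isLimit _).conePointUniqueUpToIso hl⟩

/-- After base change the components are summands of the pullback of `E`, and their limit is that
pullback. -/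
theorem SystemHom.isFamily_graph {r : ℕ} (hE : IsLocallyFreeOfRank E r) :
    (f.graph Y i p hip hpi).IsFamily r := by
  intro T g
  have hE' := hE.pullback g.left
  refine ⟨fun σ => ?_, ?_⟩
  · refine hE'.isFiniteLocallyFree_of_summand ((Scheme.Modules.pullback g.left).map (i σ))
      ((Scheme.Modules.pullback g.left).map (p σ)) ?_
    exact ((Scheme.Modules.pullback g.left).map_comp _ _).symm.trans
      ((congrArg (Scheme.Modules.pullback g.left).map (hip σ)).trans ((Scheme.Modules.pullback g.left).map_id _))
  · obtain ⟨e⟩ := f.nonempty_limit_graph_iso Y i p hip hpi (Scheme.Modules.pullback g.left)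
    exact hE'.of_iso e.symm

end GraphFamily

end SoftNC


theorem lemma4p3p2 {n : ℕ} (Δ : Fan n) (hΔ : Δ.IsSmoothWithReferenceCone) (Y : SoftScheme Δ)
    (r : ℕ) (X : Over SpecC) (E : X.left.Modules) (hE : IsLocallyFreeOfRank E r)
    (φ : AzumayaMorphism Y.structureSheaf X E) :
    ∃ F : Family Y.structureSheaf r X,
      IsGraph φ F.module ∧
        Nonempty (F.module.directImage ≅ E) ∧
          ∃ Φ : BasedFunctor (schemeStack X) (moduliStack Y.structureSheaf r),
            Classifies Φ F ∧
              ∀ Φ' : BasedFunctor (schemeStack X) (moduliStack Y.structureSheaf r),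
                Classifies Φ' F → Nonempty (Φ ≅ Φ') := by
  obtain ⟨f, hf⟩ := φ.exists_global
  choose Z i p hip hpi using fun σ : Δ.Coneᵒᵖ =>
    IsIdempotentComplete.idempotents_split E (f.actEnd σ 1)
      ((f.actEnd_comp σ 1 1).trans (by rw [mul_one]))
  refine ⟨⟨f.graph Z i p hip hpi, f.isFamily_graph Z i p hip hpi hE⟩,
    ⟨i, p, hip, fun _ _ _ => rfl, fun U g hg σ a V hV x => ?_⟩, ?_, exists_classifies _⟩
  -- The projection to `e_σ E` and its inclusion absorb `e_σ`, so `f_σ a` factors through `e_σ E`.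
  · have h1 : p σ ≫ (i σ ≫ f.actEnd σ a ≫ p σ) ≫ i σ = f.actEnd σ a := by
      simp only [Category.assoc]
      rw [reassoc_of% (hpi σ), hpi, f.actEnd_comp, f.actEnd_comp, one_mul, mul_one]
    have h2 := congrArg (fun k : E ⟶ E => k.app V x) h1
    refine h2.trans ?_
    rw [hf U g hg]
    rfl
  -- For the identity functor, the image of `E` is `E` itself.
  · exact f.nonempty_limit_graph_iso Z i p hip hpi (𝟭 _)
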